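/- Let $\mathbb{G}_3$ be the geometric (Clifford) algebra of Euclidean $\mathbb{R}^3$, with orthonormal basis $\mathbf e_1,\mathbf e_2,\mathbf e_3$, unit pseudoscalar $I=\mathbf e_1\mathbf e_2\mathbf e_3$ and grade projections $\langle\cdot\rangle_k$. For an $r$-vector $A$ and an $s$-vector $B$ put $A\cdot B=\langle AB\rangle_{|r-s|}$ and $A\wedge B=\langle AB\rangle_{r+s}$, extended bilinearly. Let $M\subset\mathbb{R}^3$ be a compact region with piecewise smooth boundary, that is: $M$ is the closure of its interior, $\partial M$ has finite area (two-dimensional Hausdorff measure, normalized to be Euclidean area), and outside a subset of $\partial M$ of zero area (edges, corners) $\partial M$ is a $C^1$ surface with $M$ locally on one side of it. Precisely, near each such regular point $x$ one has $M=\{f\le 0\}$ for a $C^1$ function $f$ with $\nabla f(x)\neq 0$, and the outward unit normal is $\hat{\mathbf n}(x)=\nabla f(x)/|\nabla f(x)|$ (put $\hat{\mathbf n}=0$ at the remaining boundary points). Let $d\mathbf x^3=I\,dV$ and $d\mathbf x^2=I\hat{\mathbf n}\,dS$ be the directed volume and surface elements. Let $F$ be a bivector-valued field of class $C^1$ on $M$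 (up to the boundary), with curl $\nabla\wedge F=\sum_i \mathbf e_i\wedge\partial_iF$. Then both integrands below are integrable and $$\iiint_M d\mathbf x^3\cdot(\nabla\wedge F)=\oiint_{\partial M} d\mathbf x^2\cdot F .$$ Moreover, this is the dual of the ordinary divergence theorem: there is a vector field $\mathbf v$ with $F=I\mathbf v$ on $M$; for it $\nabla\wedge F=(\operatorname{div}\mathbf v)\,I$ in the interior of $M$ and $(I\hat{\mathbf n})\cdot F=-\,\mathbf v\cdot\hat{\mathbf n}$ on $\partial M$, both $\operatorname{div}\mathbf v$ on $M$ and $\mathbf v\cdot\hat{\mathbf n}$ on $\partial M$ are integrable, and $$\iiint_M \operatorname{div}\mathbf v\,dV=\oiint_{\partial M}\mathbf v\cdot\hat{\mathbf n}\,dS .$$ -/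

import Mathlib

open MeasureTheory

noncomputable section

namespace GeometricCalculus

/-- Euclidean space `ℝ³` with its standard inner product. -/
abbrev R3 : Type := EuclideanSpace ℝ (Fin 3)

/-- The standard orthonormal basis vectors `e₁, e₂, e₃` (indexed by `0, 1, 2`). -/
def basisVec (i : Fin 3) : R3 := EuclideanSpace.single i 1

/-! ### The geometric algebra of `ℝ³` -/

/-- The quadratic form `v ↦ ⟪v, v⟫`. -/
def Q3 : QuadraticForm ℝ R3 := LinearMap.BilinMap.toQuadraticMap (innerₗ R3)

/-- The geometric algebra `𝔾₃`: its product is the geometric product, with `v v = ⟪v, v⟫`. -/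
abbrev G3 : Type := CliffordAlgebra Q3

/-- A vector of `ℝ³` seen as an element of `𝔾₃`. -/
def vec : R3 →ₗ[ℝ] G3 := CliffordAlgebra.ι Q3

/-- The canonical linear identification of `𝔾₃` with the exterior algebra of `ℝ³`; it sends a
product of pairwise orthogonal vectors to their wedge product. -/
def toExterior : G3 ≃ₗ[ℝ] ExteriorAlgebra ℝ R3 := CliffordAlgebra.equivExterior Q3

/-- The `k`-vectors of `𝔾₃`. -/
def kVectors (k : ℕ) : Submodule ℝ G3 := (⋀[ℝ]^k R3).comap toExterior.toLinearMap

/-- The grade projection `A ↦ ⟨A⟩ₖ`. -/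
def gradeProj (k : ℕ) : G3 →ₗ[ℝ] G3 :=
  toExterior.symm.toLinearMap ∘ₗ GradedAlgebra.proj (fun n : ℕ => ⋀[ℝ]^n R3) k ∘ₗ
    toExterior.toLinearMap

/-- Inner product of multivectors: the bilinear extension of `A · B = ⟨AB⟩_{|r-s|}` for an
`r`-vector `A` and an `s`-vector `B` (grades in `𝔾₃` run from `0` to `3`). -/
def dot (A B : G3) : G3 :=
  ∑ r ∈ Finset.range 4, ∑ s ∈ Finset.range 4,
    gradeProj ((r : ℤ) - (s : ℤ)).natAbs (gradeProj r A * gradeProj s B)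

/-- Outer product of multivectors: the bilinear extension of `A ∧ B = ⟨AB⟩_{r+s}` for an
`r`-vector `A` and an `s`-vector `B`. -/
def wedge (A B : G3) : G3 :=
  ∑ r ∈ Finset.range 4, ∑ s ∈ Finset.range 4,
    gradeProj (r + s) (gradeProj r A * gradeProj s B)

/-- The unit pseudoscalar `I = e₁e₂e₃`. -/
def pseudoscalar : G3 := vec (basisVec 0) * vec (basisVec 1) * vec (basisVec 2)

/-- The basis of `𝔾₃` corresponding to the basis `e_{i₁} ∧ ⋯ ∧ e_{iₖ}`, `i₁ < ⋯ < iₖ`, of the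
exterior algebra. -/
def bladeBasis : Module.Basis (Finset (Fin 3)) ℝ G3 :=
  ((EuclideanSpace.basisFun (Fin 3) ℝ).toBasis.ExteriorAlgebra).map toExterior.symm

/-- Coordinates in the blade basis. -/
def bladeCoords : G3 ≃ₗ[ℝ] EuclideanSpace ℝ (Finset (Fin 3)) :=
  bladeBasis.equivFun.trans (WithLp.linearEquiv 2 ℝ (Finset (Fin 3) → ℝ)).symm

/-- The Euclidean norm of the blade coordinates. All norms on the finite-dimensional space `𝔾₃` are
equivalent, so that derivatives and integrals of `𝔾₃`-valued fields do not depend on this choice. -/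
instance : NormedAddCommGroup G3 :=
  NormedAddCommGroup.induced G3 (EuclideanSpace ℝ (Finset (Fin 3))) bladeCoords
    bladeCoords.injective

instance : NormedSpace ℝ G3 :=
  NormedSpace.induced ℝ G3 (EuclideanSpace ℝ (Finset (Fin 3))) bladeCoords

instance : FiniteDimensional ℝ G3 := bladeBasis.finiteDimensional_of_finite

/-! ### Derivatives of fields on a region `M` -/

/-- The curl `∇ ∧ F = ∑ᵢ eᵢ ∧ ∂ᵢF` of a multivector field on `M`. -/
def curl (M : Set R3) (F : R3 → G3) (x : R3) : G3 :=
  ∑ i, wedge (vec (basisVec i)) (fderivWithin ℝ F M x (basisVec i))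

/-- The divergence `∑ᵢ ∂ᵢvᵢ` of a vector field on `M`. -/
def divergence (M : Set R3) (v : R3 → R3) (x : R3) : ℝ :=
  ∑ i, fderivWithin ℝ v M x (basisVec i) i

/-! ### Regions with piecewise smooth boundary -/

/-- `n` is an outward unit normal of `M` at the boundary point `x`, and the boundary is a `C¹`
surface near `x` with `M` on one side of it: near `x`, the set `M` is `{f ≤ 0}` for a `C¹` function
`f` with `∇f(x) ≠ 0`, and `n = ∇f(x) / ‖∇f(x)‖`. -/
def IsOutwardUnitNormal (M : Set R3) (x n : R3) : Prop :=
  x ∈ frontier M ∧ ∃ (U : Set R3) (f : R3 → ℝ), IsOpen U ∧ x ∈ U ∧ ContDiffOn ℝ 1 f U ∧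
    gradient f x ≠ 0 ∧ (∀ y ∈ U, y ∈ M ↔ f y ≤ 0) ∧ n = ‖gradient f x‖⁻¹ • gradient f x

/-- The regular boundary points, those at which the boundary is a `C¹` surface. -/
def regularBoundary (M : Set R3) : Set R3 := {x | ∃ n, IsOutwardUnitNormal M x n}

open scoped Classical in
/-- The outward unit normal at regular boundary points, and `0` at all other points. -/
def outwardNormal (M : Set R3) (x : R3) : R3 :=
  if h : ∃ n, IsOutwardUnitNormal M x n then h.choose else 0

/-- `M` is a compact three-dimensional region in `ℝ³` with piecewise `C¹` boundary: it is the
closure of its interior, its boundary has finite area, and the boundary is a `C¹` surface, with `M`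
on one side of it, apart from a set of zero area (edges, corners, conical points). -/
structure IsPiecewiseSmoothRegion (M : Set R3) : Prop where
  isCompact : IsCompact M
  closure_interior : closure (interior M) = M
  area_lt_top : μHE[2] (frontier M) < ⊤
  area_singular : μHE[2] (frontier M \ regularBoundary M) = 0

/-- The directed surface element `dx²` per unit of area, the tangent unit bivector `I n`. -/
def surfaceElement (M : Set R3) (x : R3) : G3 := pseudoscalar * vec (outwardNormal M x)

/-- At a boundary point, `f ≤ 0` implies `g ≤ 0` nearby only if `∇f` does not separate the
half-spaces: no direction decreases `f` and increases `g` to first order. -/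
theorem not_neg_pos_of_defining {M : Set R3} {x : R3} {U V : Set R3} {f g : R3 → ℝ}
    (hU : IsOpen U) (hxU : x ∈ U) (hf : ContDiffOn ℝ 1 f U) (hfM : ∀ y ∈ U, y ∈ M ↔ f y ≤ 0)
    (hV : IsOpen V) (hxV : x ∈ V) (hg : ContDiffOn ℝ 1 g V) (hgM : ∀ y ∈ V, y ∈ M ↔ g y ≤ 0)
    (hfx : f x ≤ 0) (hgx : 0 ≤ g x) (v : R3) (h1 : inner ℝ (gradient f x) v < 0)
    (h2 : 0 < inner ℝ (gradient g x) v) : False := by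
  have key : ∀ (W : Set R3) (k : R3 → ℝ), IsOpen W → x ∈ W → ContDiffOn ℝ 1 k W →
      HasDerivAt (fun t : ℝ => k (x + t • v)) (inner ℝ (gradient k x) v) 0 := by
    intro W k hW hxW hk
    have hd : DifferentiableAt ℝ k x :=
      (hk.contDiffAt (hW.mem_nhds hxW)).differentiableAt (by norm_num)
    have hd' : HasFDerivAt k ((InnerProductSpace.toDual ℝ R3) (gradient k x)) (x + (0 : ℝ) • v) := by
      simpa using hd.hasGradientAt.hasFDerivAt
    have hl : HasDerivAt (fun t : ℝ => x + t • v) v 0 := by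
      simpa using ((hasDerivAt_id (0 : ℝ)).smul_const v).const_add x
    have hcomp := hd'.comp_hasDerivAt (0 : ℝ) hl
    rw [InnerProductSpace.toDual_apply_apply] at hcomp
    exact hcomp
  have hc : Filter.Tendsto (fun t : ℝ => x + t • v) (nhdsWithin 0 (Set.Ioi 0)) (nhds x) := by
    have : Continuous (fun t : ℝ => x + t • v) := by fun_prop
    have h := (this.tendsto 0).mono_left (nhdsWithin_le_nhds (s := Set.Ioi 0))
    simpa using h
  have hslope : ∀ (k : R3 → ℝ) (c : ℝ), HasDerivAt (fun t : ℝ => k (x + t • v)) c 0 →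
      Filter.Tendsto (fun t : ℝ => t⁻¹ * (k (x + t • v) - k x)) (nhdsWithin 0 (Set.Ioi 0))
        (nhds c) := by
    intro k c hk
    have := hk.tendsto_slope_zero_right
    simpa using this
  have e1 := (hslope f _ (key U f hU hxU hf)).eventually_lt_const h1
  have e2 := (hslope g _ (key V g hV hxV hg)).eventually_const_lt h2
  have e3 := hc.eventually (hU.mem_nhds hxU)
  have e4 := hc.eventually (hV.mem_nhds hxV)
  obtain ⟨t, h1, h2, h3, h4, ht⟩ :=
    (e1.and (e2.and (e3.and (e4.and self_mem_nhdsWithin)))).exists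
  have ht0 : (0 : ℝ) < t⁻¹ := inv_pos.mpr ht
  have a1 : f (x + t • v) ≤ 0 := by nlinarith [neg_of_mul_neg_right h1 ht0.le]
  have a2 : 0 < g (x + t • v) := by nlinarith [pos_of_mul_pos_right h2 ht0.le]
  exact absurd ((hgM _ h4).1 ((hfM _ h3).2 a1)) (not_le.mpr a2)

theorem eq_zero_of_defining {M : Set R3} {x : R3} {U : Set R3} {f : R3 → ℝ} (hx : x ∈ frontier M)
    (hU : IsOpen U) (hxU : x ∈ U) (hf : ContDiffOn ℝ 1 f U) (hfM : ∀ y ∈ U, y ∈ M ↔ f y ≤ 0) :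
    f x = 0 := by
  have hcont : ContinuousAt f x := (hf.contDiffAt (hU.mem_nhds hxU)).continuousAt
  rw [frontier_eq_closure_inter_closure] at hx
  apply le_antisymm
  · by_contra! h
    have : Mᶜ ∈ nhds x := by
      filter_upwards [hcont.eventually (lt_mem_nhds h), hU.mem_nhds hxU] with y hy hyU hyM
      exact absurd ((hfM y hyU).1 hyM) (not_le.mpr hy)
    obtain ⟨y, hy, hyM⟩ := mem_closure_iff_nhds.1 hx.1 _ this
    exact hy hyM
  · by_contra! h
    have : M ∈ nhds x := by
      filter_upwards [hcont.eventually (gt_mem_nhds h), hU.mem_nhds hxU] with y hy hyU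
      exact (hfM y hyU).2 (le_of_lt hy)
    obtain ⟨y, hy, hyM⟩ := mem_closure_iff_nhds.1 hx.2 _ this
    exact hyM hy

/-- The outward unit normal at a regular boundary point is unique. -/
theorem isOutwardUnitNormal_unique {M : Set R3} {x m n : R3} (hm : IsOutwardUnitNormal M x m)
    (hn : IsOutwardUnitNormal M x n) : m = n := by
  obtain ⟨hx, U, f, hU, hxU, hf, hf0, hfM, rfl⟩ := hm
  obtain ⟨-, V, g, hV, hxV, hg, hg0, hgM, rfl⟩ := hn
  have hfx := eq_zero_of_defining hx hU hxU hf hfM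
  have hgx := eq_zero_of_defining hx hV hxV hg hgM
  have hpf : 0 < ‖gradient f x‖ := norm_pos_iff.2 hf0
  have hpg : 0 < ‖gradient g x‖ := norm_pos_iff.2 hg0
  set a := ‖gradient f x‖⁻¹ • gradient f x with ha
  set b := ‖gradient g x‖⁻¹ • gradient g x with hb
  have na : ‖a‖ = 1 := by rw [ha, norm_smul, norm_inv, norm_norm, inv_mul_cancel₀ hpf.ne']
  have nb : ‖b‖ = 1 := by rw [hb, norm_smul, norm_inv, norm_norm, inv_mul_cancel₀ hpg.ne']
  have fa : gradient f x = ‖gradient f x‖ • a := by rw [ha, smul_inv_smul₀ hpf.ne']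
  have gb : gradient g x = ‖gradient g x‖ • b := by rw [hb, smul_inv_smul₀ hpg.ne']
  by_contra hne
  have hab : inner ℝ a b < 1 := (inner_lt_one_iff_real_of_norm_eq_one na nb).2 hne
  refine not_neg_pos_of_defining hU hxU hf hfM hV hxV hg hgM hfx.le hgx.ge (b - a) ?_ ?_
  · rw [fa, real_inner_smul_left, inner_sub_right, real_inner_self_eq_norm_sq, na]
    nlinarith
  · rw [gb, real_inner_smul_left, inner_sub_right, real_inner_self_eq_norm_sq, nb,
      real_inner_comm]
    nlinarith

theorem isOutwardUnitNormal_outwardNormal {M : Set R3} {x : R3} (hx : x ∈ regularBoundary M) :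
    IsOutwardUnitNormal M x (outwardNormal M x) := by
  unfold outwardNormal
  rw [dif_pos (show ∃ n, IsOutwardUnitNormal M x n from hx)]
  exact Exists.choose_spec _

end GeometricCalculus

end

open GeometricCalculus

/-! Duality reduces the claim to the divergence theorem. In dimension three `I` commutes with
vectors and `I² = -1`, so the bivectors are exactly the `I v` (`kVectors_two_eq_range_dualMap`),
with `a ∧ (I u) = ⟪a, u⟫ I` and `(I u) · (I v) = -⟪u, v⟫`. Writing `F = I v`, both sides of the curl
theorem become minus the two sides of the divergence theorem for `v`.

For the divergence theorem, work with one scalar `w` and one direction `e`: the `fluxDefect` of `w`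
must vanish. No charts and no area formula are used. Near a regular boundary point `p` with normal
`n`, let `w ≥ 0` be supported in a small ball, let `L d` be the integral of `∂_d w` over the
interior and `W` the integral of `w` over the boundary. For a unit vector `d` transversal to the
boundary, Fubini along lines in direction `d` turns `L d` into the integral of `w` over the shadow
of the boundary (`integral_fderiv_eq_integral_liftedValue`). Projection does not increase area, so
`L d ≤ ‖d‖ W` for all `d` in a wide cone around `n`; the boundary is nearly orthogonal to `n`, so `L
n ≥ (1 - η²) W`. Thus the linear functional `L` almost attains the bound `‖d‖ W` at `d = n`, and
comparing first-order variations there forces `L e ≈ ⟪n, e⟫ W` (`exists_ball_flux_near_tangent`).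

The local errors are at most `ε` times the local boundary mass of the weight, so a partition of
unity sums them to at most `ε` times a fixed constant; hence the defect is zero for `w` vanishing
near the singular set. That set is compact of zero area, so it is covered by finitely many balls
with `∑ ρ²` small. The gradient of a bump of radius `ρ` has integral of order `ρ²`, so cutting off
near the singular set costs nothing in the limit (`exists_cutoff`, `fluxDefect_eq_zero`). -/

open Set in
theorem exists_eq_Ioo_of_isOpen_ordConnected {J : Set ℝ} (ho : IsOpen J) (hc : J.OrdConnected)
    (hb : Bornology.IsBounded J) (hne : J.Nonempty) : ∃ a b, a < b ∧ J = Ioo a b := by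
  have hconn : IsConnected J := ⟨hne, hc.isPreconnected⟩
  have hsub : J ⊆ Ioo (sInf J) (sSup J) := by
    intro x hx
    obtain ⟨l, hl⟩ := exists_Ioc_subset_of_mem_nhds (ho.mem_nhds hx) ⟨x - 1, by simp⟩
    obtain ⟨u, hu⟩ := exists_Ico_subset_of_mem_nhds (ho.mem_nhds hx) ⟨x + 1, by simp⟩
    obtain ⟨l', h1, h2⟩ := exists_between hl.1
    obtain ⟨u', h3, h4⟩ := exists_between hu.1
    exact ⟨(csInf_le hb.bddBelow (hl.2 ⟨h1, h2.le⟩)).trans_lt h2,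
      h3.trans_le (le_csSup hb.bddAbove (hu.2 ⟨h3.le, h4⟩))⟩
  have heq := hsub.antisymm (hconn.Ioo_csInf_csSup_subset hb.bddBelow hb.bddAbove)
  obtain ⟨x, hx⟩ := hne
  have := hsub hx
  exact ⟨_, _, this.1.trans this.2, heq⟩

open Set in
theorem setIntegral_Ioo_deriv {C : Set ℝ} (hC : IsClosed C) {h h' : ℝ → ℝ} {a b : ℝ} (hab : a < b)
    (hcont : ContinuousOn h C) (hsub : Ioo a b ⊆ C) (hd : ∀ t ∈ Ioo a b, HasDerivAt h (h' t) t)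
    (hint : IntegrableOn h' (Ioo a b)) : ∫ t in Ioo a b, h' t = h b - h a := by
  have hcl : Icc a b ⊆ C := by
    rw [← closure_Ioo hab.ne]; exact hC.closure_subset_iff.2 hsub
  rw [← integral_Ioc_eq_integral_Ioo, ← intervalIntegral.integral_of_le hab.le]
  refine intervalIntegral.integral_eq_sub_of_hasDerivAt_of_le hab.le (hcont.mono hcl) hd ?_
  rwa [intervalIntegrable_iff_integrableOn_Ioo_of_le hab.le]

/-! ### The fundamental theorem of calculus on a line crossing the region. -/

section Line

open Set

variable {J O C : Set ℝ} {h h' : ℝ → ℝ}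

/-- Here `J`, `O`, `C` are the traces on a line of a ball, of the interior of the region, and of the
region. The line runs inside until `t₀` and outside afterwards, so `O ∩ J` is an interval ending at
`t₀`. Its left end lies in `C` but not in `J`, where `h` vanishes, and only the value at `t₀`
survives. -/
theorem setIntegral_deriv_eq_of_exit (hJo : IsOpen J) (hJc : J.OrdConnected)
    (hJb : Bornology.IsBounded J) (hC : IsClosed C)
    (hcont : ContinuousOn h C) (hd : ∀ t ∈ O, HasDerivAt h (h' t) t)
    (hint : IntegrableOn h' (O ∩ J)) (h0 : ∀ t ∈ C \ J, h t = 0) (hOC : O ⊆ C)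
    {t₀ : ℝ} (ht₀ : t₀ ∈ J) (ht₀O : t₀ ∉ O) (hlt : ∀ t ∈ J, t < t₀ → t ∈ O)
    (hgt : ∀ t ∈ J, t₀ < t → t ∉ C) : ∫ t in O ∩ J, h' t = h t₀ := by
  obtain ⟨a, b, -, rfl⟩ := exists_eq_Ioo_of_isOpen_ordConnected hJo hJc hJb ⟨_, ht₀⟩
  have hE : O ∩ Ioo a b = Ioo a t₀ := by
    ext t
    refine ⟨fun ht => ⟨ht.2.1, ?_⟩, fun ht => ?_⟩
    · rcases lt_trichotomy t t₀ with h | h | h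
      · exact h
      · exact absurd (h ▸ ht.1) ht₀O
      · exact absurd (hOC ht.1) (hgt t ht.2 h)
    · have : t ∈ Ioo a b := ⟨ht.1, ht.2.trans ht₀.2⟩
      exact ⟨hlt t this ht.2, this⟩
  have hO : Ioo a t₀ ⊆ O := hE ▸ inter_subset_left
  rw [hE] at hint ⊢
  rw [setIntegral_Ioo_deriv hC ht₀.1 hcont (hO.trans hOC) (fun t ht => hd t (hO ht)) hint]
  have haC : a ∈ C := hC.closure_subset_iff.2 (hO.trans hOC) (by
    rw [closure_Ioo ht₀.1.ne]; exact left_mem_Icc.2 ht₀.1.le)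
  rw [h0 a ⟨haC, fun h => lt_irrefl _ h.1⟩, sub_zero]

/-- An interval that meets `C` only inside `O` is covered by the disjoint open sets `O` and `Cᶜ`, so
connectedness puts it in one of them: either `h` vanishes at both ends, or there is nothing to
integrate. -/
theorem setIntegral_deriv_eq_zero_of_no_exit (hJo : IsOpen J) (hJc : J.OrdConnected)
    (hJb : Bornology.IsBounded J) (hO : IsOpen O) (hC : IsClosed C)
    (hcont : ContinuousOn h C) (hd : ∀ t ∈ O, HasDerivAt h (h' t) t)
    (hint : IntegrableOn h' (O ∩ J)) (h0 : ∀ t ∈ C \ J, h t = 0) (hOC : O ⊆ C)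
    (hJ : ∀ t ∈ J, t ∈ C → t ∈ O) : ∫ t in O ∩ J, h' t = 0 := by
  rcases J.eq_empty_or_nonempty with rfl | hne
  · simp
  obtain ⟨a, b, hab, rfl⟩ := exists_eq_Ioo_of_isOpen_ordConnected hJo hJc hJb hne
  have hdisj : Disjoint O Cᶜ := disjoint_compl_right_iff_subset.2 hOC
  have hcov : Ioo a b ⊆ O ∪ Cᶜ := fun t ht => by
    by_cases htC : t ∈ C
    · exact Or.inl (hJ t ht htC)
    · exact Or.inr htC
  rcases IsPreconnected.subset_or_subset hO hC.isOpen_compl hdisj hcov isPreconnected_Ioo with h | h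
  · rw [inter_eq_self_of_subset_right h] at hint ⊢
    have hcl : closure (Ioo a b) ⊆ C := hC.closure_subset_iff.2 (h.trans hOC)
    rw [closure_Ioo hab.ne] at hcl
    rw [setIntegral_Ioo_deriv hC hab hcont (h.trans hOC) (fun t ht => hd t (h ht)) hint,
      h0 b ⟨hcl (right_mem_Icc.2 hab.le), fun h => lt_irrefl _ h.2⟩,
      h0 a ⟨hcl (left_mem_Icc.2 hab.le), fun h => lt_irrefl _ h.1⟩, sub_zero]
  · have : O ∩ Ioo a b = ∅ := by
      ext t; simp only [mem_inter_iff, mem_empty_iff_false, iff_false]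
      exact fun ht => h ht.2 (hOC ht.1)
    simp [this]

end Line

/-- Coordinates `(y, t)` on `ℝ³` such that `t` is the coordinate in direction `d`. -/
theorem exists_linearIsometryEquiv_snd_eq {d : R3} (hd : ‖d‖ = 1) :
    ∃ e : WithLp 2 (EuclideanSpace ℝ (Fin 2) × ℝ) ≃ₗᵢ[ℝ] R3,
      ∀ y t, e (WithLp.toLp 2 (y, t)) = e (WithLp.toLp 2 (y, 0)) + t • d := by
  have hfin : Module.finrank ℝ (WithLp 2 (EuclideanSpace ℝ (Fin 2) × ℝ)) = 3 := by
    rw [(WithLp.linearEquiv 2 ℝ (EuclideanSpace ℝ (Fin 2) × ℝ)).finrank_eq]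
    simp
  let e₀ : WithLp 2 (EuclideanSpace ℝ (Fin 2) × ℝ) ≃ₗᵢ[ℝ] R3 :=
    ((stdOrthonormalBasis ℝ _).reindex (finCongr hfin)).repr
  set d₀ := e₀ (WithLp.toLp 2 (0, 1)) with hd₀
  have hn : ‖d₀‖ = ‖d‖ := by
    rw [hd₀, LinearIsometryEquiv.norm_map, hd, WithLp.prod_norm_eq_of_L2]; simp
  -- An arbitrary isometry sends the height axis to some unit vector `d₀`; the reflection in the
  -- hyperplane orthogonal to `d₀ - d` then takes `d₀` to `d`.
  refine ⟨e₀.trans (Submodule.reflection (ℝ ∙ (d₀ - d))ᗮ), fun y t => ?_⟩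
  have h1 : (WithLp.toLp 2 (y, t) : WithLp 2 (EuclideanSpace ℝ (Fin 2) × ℝ)) =
      WithLp.toLp 2 (y, 0) + t • WithLp.toLp 2 (0, 1) := by
    rw [← WithLp.toLp_smul, ← WithLp.toLp_add]; simp
  rw [h1, map_add, map_smul]
  congr 2
  exact Submodule.reflection_sub hn

theorem LipschitzOnWith.euclideanHausdorffMeasure_image_le {X Y : Type*} [EMetricSpace X]
    [MeasurableSpace X] [BorelSpace X] [EMetricSpace Y] [MeasurableSpace Y] [BorelSpace Y]
    {K : NNReal} {f : X → Y} {s : Set X} (h : LipschitzOnWith K f s) (n : ℕ) :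
    μHE[n] (f '' s) ≤ (K : ENNReal) ^ n * μHE[n] s := by
  simp only [Measure.euclideanHausdorffMeasure_def, Measure.smul_apply]
  have := h.hausdorffMeasure_image_le (d := n) n.cast_nonneg
  rw [ENNReal.rpow_natCast] at this
  rw [mul_smul_comm]
  gcongr

/-! ### Orthogonal projection along a direction, and the product coordinates. -/

section LineProjection

open Set

variable (e : WithLp 2 (EuclideanSpace ℝ (Fin 2) × ℝ) ≃ₗᵢ[ℝ] R3)

/-- The plane coordinates of a point. -/
noncomputable def planeCoord (x : R3) : EuclideanSpace ℝ (Fin 2) := (e.symm x).ofLp.1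

/-- The point with the given plane coordinates and height. -/
noncomputable def pointOf (y : EuclideanSpace ℝ (Fin 2)) (t : ℝ) : R3 := e (WithLp.toLp 2 (y, t))

theorem pointOf_planeCoord (x : R3) : pointOf e (planeCoord e x) (e.symm x).ofLp.2 = x :=
  e.apply_symm_apply x

@[simp] theorem planeCoord_pointOf (y : EuclideanSpace ℝ (Fin 2)) (t : ℝ) :
    planeCoord e (pointOf e y t) = y := by
  simp [pointOf, planeCoord]

theorem norm_sq_eq_planeCoord (x : R3) :
    ‖x‖ ^ 2 = ‖planeCoord e x‖ ^ 2 + (e.symm x).ofLp.2 ^ 2 := by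
  rw [← e.symm.norm_map x, WithLp.prod_norm_sq_eq_of_L2]
  simp [planeCoord]

theorem planeCoord_sub (x x' : R3) :
    planeCoord e (x - x') = planeCoord e x - planeCoord e x' := by
  simp [planeCoord]

theorem lipschitzWith_planeCoord : LipschitzWith 1 (planeCoord e) := by
  refine LipschitzWith.of_dist_le_mul fun x x' => ?_
  rw [dist_eq_norm, dist_eq_norm, ← planeCoord_sub, NNReal.coe_one, one_mul]
  refine le_of_sq_le_sq ?_ (norm_nonneg _)
  rw [norm_sq_eq_planeCoord e (x - x')]
  nlinarith [sq_nonneg (e.symm (x - x')).ofLp.2]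

theorem continuous_pointOf : Continuous fun q : EuclideanSpace ℝ (Fin 2) × ℝ =>
    pointOf e q.1 q.2 :=
  e.continuous.comp (WithLp.prod_continuous_toLp 2 _ _)

theorem measurableEmbedding_pointOf : MeasurableEmbedding
    fun q : EuclideanSpace ℝ (Fin 2) × ℝ => pointOf e q.1 q.2 := by
  refine (continuous_pointOf e).measurableEmbedding fun q q' h => ?_
  simpa [pointOf] using congrArg (fun x => (e.symm x).ofLp) h

theorem measurePreserving_pointOf : MeasurePreserving
    (fun q : EuclideanSpace ℝ (Fin 2) × ℝ => pointOf e q.1 q.2) volume volume :=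
  e.measurePreserving.comp (WithLp.volume_preserving_toLp _ _)

variable {e} {d : R3} (he : ∀ y t, pointOf e y t = pointOf e y 0 + t • d)

include he

theorem symm_snd_eq_inner (x : R3) : (e.symm x).ofLp.2 = inner ℝ d x := by
  have h1 : d = e (WithLp.toLp 2 (0, 1)) := by
    have := he 0 1
    have h0 : pointOf e 0 0 = 0 := by
      have : (WithLp.toLp 2 (0, 0) : WithLp 2 (EuclideanSpace ℝ (Fin 2) × ℝ)) = 0 := rfl
      simp [pointOf, this]
    rw [h0, zero_add, one_smul] at this
    exact this.symm
  conv_rhs => rw [h1, ← e.apply_symm_apply x, e.inner_map_map, WithLp.prod_inner_apply]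
  simp

end LineProjection

/-! ### Line integrals of the directional derivative. -/

section LineIntegral

open Set Metric

/-- Within the ball, lines in direction `d` leave `M` transversally wherever they meet its
frontier. -/
def ExitsAlong (M : Set R3) (p : R3) (r : ℝ) (d : R3) : Prop :=
  ∀ x ∈ frontier M ∩ ball p r, ∀ s : ℝ, 0 < s →
    (x - s • d ∈ ball p r → x - s • d ∈ interior M) ∧ (x + s • d ∈ ball p r → x + s • d ∉ M)

variable {e : WithLp 2 (EuclideanSpace ℝ (Fin 2) × ℝ) ≃ₗᵢ[ℝ] R3}
  {d : R3} (he : ∀ y t, pointOf e y t = pointOf e y 0 + t • d)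
  {M : Set R3} (hM : IsClosed M) {p : R3} {r : ℝ} (hX : ExitsAlong M p r d) {w : R3 → ℝ}
  (hwc : ContinuousOn w M) (hwd : DifferentiableOn ℝ w (interior M))
  (hw0 : ∀ x ∈ M \ ball p r, w x = 0)

include he in
theorem pointOf_add_smul (y : EuclideanSpace ℝ (Fin 2)) (t s : ℝ) :
    pointOf e y (t + s) = pointOf e y t + s • d := by
  rw [he, he y t, add_smul, add_assoc]

theorem continuous_pointOf_right (y : EuclideanSpace ℝ (Fin 2)) :
    Continuous (pointOf e y) :=
  (continuous_pointOf e).comp (by fun_prop : Continuous fun t : ℝ => (y, t))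

include he in
theorem ordConnected_preimage_ball (y : EuclideanSpace ℝ (Fin 2)) :
    (pointOf e y ⁻¹' ball p r).OrdConnected := by
  have hline : pointOf e y = fun t => AffineMap.lineMap (pointOf e y 0) (pointOf e y 0 + d) t := by
    ext1 t; rw [he, AffineMap.lineMap_apply]; simp [add_comm]
  rw [hline]
  exact ((convex_ball p r).affine_preimage _).ordConnected

theorem isBounded_preimage_ball (y : EuclideanSpace ℝ (Fin 2)) :
    Bornology.IsBounded (pointOf e y ⁻¹' ball p r) := by
  have hA : AntilipschitzWith 1 (pointOf e y) := by
    refine AntilipschitzWith.of_le_mul_dist fun t t' => ?_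
    unfold pointOf
    rw [e.dist_map, WithLp.prod_dist_eq_of_L2]
    simp
  exact hA.isBounded_preimage isBounded_ball

include he hwd in
theorem hasDerivAt_comp_pointOf (y : EuclideanSpace ℝ (Fin 2)) (t : ℝ)
    (ht : pointOf e y t ∈ interior M) :
    HasDerivAt (fun t => w (pointOf e y t)) (fderiv ℝ w (pointOf e y t) d) t := by
  have h1 : HasFDerivAt w (fderiv ℝ w (pointOf e y t)) (pointOf e y t) :=
    (hwd.differentiableAt (isOpen_interior.mem_nhds ht)).hasFDerivAt
  have h2 : HasDerivAt (pointOf e y) d t := by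
    have : HasDerivAt (fun t : ℝ => pointOf e y 0 + t • d) d t := by
      simpa using ((hasDerivAt_id t).smul_const d).const_add (pointOf e y 0)
    exact this.congr_of_eventuallyEq (Filter.Eventually.of_forall (he y))
  exact h1.comp_hasDerivAt t h2

include he hM hX hwc hwd hw0 in
theorem lineIntegral_eq_of_mem_frontier {x : R3} (hx : x ∈ frontier M ∩ ball p r)
    (hint : IntegrableOn (fun t => fderiv ℝ w (pointOf e (planeCoord e x) t) d)
      (pointOf e (planeCoord e x) ⁻¹' (interior M ∩ ball p r))) :
    ∫ t in pointOf e (planeCoord e x) ⁻¹' (interior M ∩ ball p r),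
      fderiv ℝ w (pointOf e (planeCoord e x) t) d = w x := by
  set y := planeCoord e x with hy
  have hγ := continuous_pointOf_right (e := e) y
  have hx0 : pointOf e y (e.symm x).ofLp.2 = x := pointOf_planeCoord e x
  set t₀ := (e.symm x).ofLp.2
  rw [preimage_inter] at hint ⊢
  rw [setIntegral_deriv_eq_of_exit (h := fun t => w (pointOf e y t)) (C := pointOf e y ⁻¹' M)
    (O := pointOf e y ⁻¹' interior M) (t₀ := t₀) (isOpen_ball.preimage hγ) (ordConnected_preimage_ball he y)
    (isBounded_preimage_ball y) (hM.preimage hγ) (hwc.comp hγ.continuousOn (mapsTo_preimage _ _))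
    (fun t ht => hasDerivAt_comp_pointOf he hwd y t ht) hint (fun t ht => hw0 _ ht)
    (preimage_mono interior_subset), hx0]
  · rw [mem_preimage, hx0]; exact hx.2
  · rw [mem_preimage, hx0]; exact hx.1.2
  · intro t ht htt
    have := (hX x hx (t₀ - t) (sub_pos.2 htt)).1
    rw [← hx0, sub_eq_add_neg, ← neg_smul, ← pointOf_add_smul he] at this
    rw [mem_preimage] at ht ⊢
    simpa using this (by simpa using ht)
  · intro t ht htt
    have := (hX x hx (t - t₀) (sub_pos.2 htt)).2
    rw [← hx0, ← pointOf_add_smul he] at this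
    rw [mem_preimage] at ht ⊢
    simpa using this (by simpa using ht)

include he hM hwc hwd hw0 in
theorem lineIntegral_eq_zero {y : EuclideanSpace ℝ (Fin 2)}
    (hy : y ∉ planeCoord e '' (frontier M ∩ ball p r))
    (hint : IntegrableOn (fun t => fderiv ℝ w (pointOf e y t) d)
      (pointOf e y ⁻¹' (interior M ∩ ball p r))) :
    ∫ t in pointOf e y ⁻¹' (interior M ∩ ball p r), fderiv ℝ w (pointOf e y t) d = 0 := by
  have hγ := continuous_pointOf_right (e := e) y
  rw [preimage_inter] at hint ⊢
  refine setIntegral_deriv_eq_zero_of_no_exit (h := fun t => w (pointOf e y t))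
    (C := pointOf e y ⁻¹' M) (isOpen_ball.preimage hγ) (ordConnected_preimage_ball he y)
    (isBounded_preimage_ball y) (isOpen_interior.preimage hγ) (hM.preimage hγ)
    (hwc.comp hγ.continuousOn (mapsTo_preimage _ _))
    (fun t ht => hasDerivAt_comp_pointOf he hwd y t ht) hint (fun t ht => hw0 _ ht)
    (preimage_mono interior_subset) fun t ht htM => ?_
  by_contra hcon
  exact hy ⟨_, ⟨⟨subset_closure htM, hcon⟩, ht⟩, planeCoord_pointOf e y t⟩

include he hX in
-- Of two frontier points on the same line, the lower one would have to be interior, by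
-- transversality at the upper one.
theorem injOn_planeCoord : InjOn (planeCoord e) (frontier M ∩ ball p r) := by
  have key : ∀ x ∈ frontier M ∩ ball p r, ∀ x' ∈ frontier M ∩ ball p r,
      planeCoord e x = planeCoord e x' → ¬ (e.symm x).ofLp.2 < (e.symm x').ofLp.2 := by
    intro x hx x' hx' h hlt
    have hxx : x' - ((e.symm x').ofLp.2 - (e.symm x).ofLp.2) • d = x := by
      conv_lhs => enter [1]; rw [← pointOf_planeCoord e x']
      rw [sub_eq_add_neg, ← neg_smul, ← pointOf_add_smul he, ← h, neg_sub, add_sub_cancel,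
        pointOf_planeCoord]
    have := (hX x' hx' _ (sub_pos.2 hlt)).1
    rw [hxx] at this
    exact hx.1.2 (this hx.2)
  intro x hx x' hx' h
  rw [← pointOf_planeCoord e x, ← pointOf_planeCoord e x', h,
    le_antisymm (not_lt.1 (key x' hx' x hx h.symm)) (not_lt.1 (key x hx x' hx' h))]

end LineIntegral

/-! ### Flux as an integral over the shadow, and shadow area against surface area. -/

section Flux

open Set Metric

/-- The value of `w` at the point of `S` lying over `y`, or `0` if there is none. -/
noncomputable def liftedValue (e : WithLp 2 (EuclideanSpace ℝ (Fin 2) × ℝ) ≃ₗᵢ[ℝ] R3) (S : Set R3)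
    (w : R3 → ℝ) : EuclideanSpace ℝ (Fin 2) → ℝ :=
  (planeCoord e '' S).indicator fun y => w (Function.invFunOn (planeCoord e) S y)

variable {e : WithLp 2 (EuclideanSpace ℝ (Fin 2) × ℝ) ≃ₗᵢ[ℝ] R3}
  {d : R3} (he : ∀ y t, pointOf e y t = pointOf e y 0 + t • d)
  {M : Set R3} {p : R3} {r : ℝ} (hX : ExitsAlong M p r d) {w : R3 → ℝ}

theorem liftedValue_planeCoord {S : Set R3} (hS : InjOn (planeCoord e) S) {x : R3} (hx : x ∈ S) :
    liftedValue e S w (planeCoord e x) = w x := by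
  rw [liftedValue, indicator_of_mem (mem_image_of_mem _ hx), hS.leftInvOn_invFunOn hx]

include he hX in
-- Fubini: for almost every `y` the slice is integrable, and its line integral is the value of `w`
-- at the exit point, or `0` if the line misses the frontier. Integrability of the lifted value
-- comes out of the same argument, so the inverse of the projection needs no separate measurability
-- proof.
theorem integral_fderiv_eq_integral_liftedValue (hM : IsClosed M)
    (hwc : ContinuousOn w M) (hwd : DifferentiableOn ℝ w (interior M))
    (hw0 : ∀ x ∈ M \ ball p r, w x = 0)
    (hwi : IntegrableOn (fun x => fderiv ℝ w x d) (interior M ∩ ball p r)) :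
    Integrable (liftedValue e (frontier M ∩ ball p r) w) ∧
    ∫ x in interior M ∩ ball p r, fderiv ℝ w x d =
      ∫ y, liftedValue e (frontier M ∩ ball p r) w y := by
  set S := interior M ∩ ball p r with hS
  have hSm : MeasurableSet S := (isOpen_interior.inter isOpen_ball).measurableSet
  set Ψ := fun q : EuclideanSpace ℝ (Fin 2) × ℝ => pointOf e q.1 q.2 with hΨ
  have hΨm : MeasurableSet (Ψ ⁻¹' S) := (measurableEmbedding_pointOf e).measurable hSm
  have hint : Integrable ((Ψ ⁻¹' S).indicator fun q => fderiv ℝ w (Ψ q) d)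
      ((volume : Measure (EuclideanSpace ℝ (Fin 2))).prod (volume : Measure ℝ)) := by
    rw [integrable_indicator_iff hΨm]
    exact ((measurePreserving_pointOf e).integrableOn_comp_preimage
      (measurableEmbedding_pointOf e)).2 hwi
  have hind : ∀ y t, (Ψ ⁻¹' S).indicator (fun q => fderiv ℝ w (Ψ q) d) (y, t) =
      (pointOf e y ⁻¹' S).indicator (fun t => fderiv ℝ w (pointOf e y t) d) t := fun y t => rfl
  have hym : ∀ y, MeasurableSet (pointOf e y ⁻¹' S) := fun y =>
    (continuous_pointOf_right y).measurable hSm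
  have hae : (fun y => ∫ t, (Ψ ⁻¹' S).indicator (fun q => fderiv ℝ w (Ψ q) d) (y, t)) =ᵐ[volume]
      liftedValue e (frontier M ∩ ball p r) w := by
    filter_upwards [hint.prod_right_ae] with y hy
    simp_rw [hind] at hy ⊢
    rw [integrable_indicator_iff (hym y)] at hy
    rw [integral_indicator (hym y)]
    by_cases hyS : y ∈ planeCoord e '' (frontier M ∩ ball p r)
    · obtain ⟨x, hx, rfl⟩ := hyS
      rw [liftedValue_planeCoord (injOn_planeCoord he hX) hx,
        lineIntegral_eq_of_mem_frontier he hM hX hwc hwd hw0 hx hy]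
    · rw [liftedValue, indicator_of_notMem hyS, lineIntegral_eq_zero he hM hwc hwd hw0 hyS hy]
  refine ⟨hint.integral_prod_left.congr hae, ?_⟩
  rw [← integral_congr_ae hae, ← integral_prod _ hint, integral_indicator hΨm,
    ← (measurePreserving_pointOf e).setIntegral_preimage_emb (measurableEmbedding_pointOf e)]
  rfl

theorem measurableSet_planeCoord_image {S : Set R3} (hSm : MeasurableSet S)
    (hS : InjOn (planeCoord e) S) : MeasurableSet (planeCoord e '' S) :=
  hSm.image_of_continuousOn_injOn (lipschitzWith_planeCoord e).continuous.continuousOn hS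

/-- Orthogonal projection is 1-Lipschitz, so the shadow of a set has at most its area. -/
theorem restrict_image_le_map_planeCoord (S : Set R3) :
    (volume.restrict (planeCoord e '' S) : Measure (EuclideanSpace ℝ (Fin 2))) ≤
      (μHE[2].restrict S).map (planeCoord e) := by
  have hπ := (lipschitzWith_planeCoord e).continuous.measurable
  refine Measure.le_iff.2 fun A hA => ?_
  rw [Measure.restrict_apply hA, Measure.map_apply hπ hA, Measure.restrict_apply (hπ hA),
    ← EuclideanSpace.euclideanHausdorffMeasure_eq_volume, inter_comm, ← image_inter_preimage,
    inter_comm]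
  simpa using ((lipschitzWith_planeCoord e).lipschitzOnWith
    (s := planeCoord e ⁻¹' A ∩ S)).euclideanHausdorffMeasure_image_le 2

/-- By Pythagoras a nearly horizontal set loses at most the fraction `η²` of its squared distances
under projection. The inverse is therefore Lipschitz with constant `(1 - η²)^(-1/2)`, which is
squared for areas. -/
theorem map_planeCoord_le_restrict_image {S : Set R3} (hS : InjOn (planeCoord e) S) {η : ℝ} (hη0 : 0 ≤ η) (hη1 : η < 1)
    (hη : ∀ x ∈ S, ∀ x' ∈ S, |(e.symm (x - x')).ofLp.2| ≤ η * ‖x - x'‖) :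
    (μHE[2].restrict S).map (planeCoord e) ≤
      ENNReal.ofReal (1 - η ^ 2)⁻¹ •
        (volume.restrict (planeCoord e '' S) : Measure (EuclideanSpace ℝ (Fin 2))) := by
  have hπ := (lipschitzWith_planeCoord e).continuous.measurable
  have hpos : 0 < 1 - η ^ 2 := by nlinarith
  set K : NNReal := Real.toNNReal (Real.sqrt (1 - η ^ 2)⁻¹) with hK
  have hK2 : (K : ENNReal) ^ 2 = ENNReal.ofReal (1 - η ^ 2)⁻¹ := by
    rw [hK, ENNReal.ofNNReal_toNNReal, ← ENNReal.ofReal_pow (Real.sqrt_nonneg _),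
      Real.sq_sqrt (inv_pos.2 hpos).le]
  have hlip : LipschitzOnWith K (Function.invFunOn (planeCoord e) S) (planeCoord e '' S) := by
    refine LipschitzOnWith.of_dist_le_mul ?_
    rintro _ ⟨x, hx, rfl⟩ _ ⟨x', hx', rfl⟩
    rw [hS.leftInvOn_invFunOn hx, hS.leftInvOn_invFunOn hx', dist_eq_norm, dist_eq_norm,
      ← planeCoord_sub, hK, Real.coe_toNNReal _ (Real.sqrt_nonneg _)]
    refine le_of_sq_le_sq ?_ (by positivity)
    rw [mul_pow, Real.sq_sqrt (inv_pos.2 hpos).le, inv_mul_eq_div, le_div_iff₀ hpos]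
    have h1 := norm_sq_eq_planeCoord e (x - x')
    have h2 := sq_le_sq' (by linarith [neg_abs_le (e.symm (x - x')).ofLp.2, hη x hx x' hx'])
      ((le_abs_self _).trans (hη x hx x' hx'))
    nlinarith
  refine Measure.le_iff.2 fun A hA => ?_
  rw [Measure.smul_apply, smul_eq_mul, Measure.restrict_apply hA, Measure.map_apply hπ hA,
    Measure.restrict_apply (hπ hA), ← EuclideanSpace.euclideanHausdorffMeasure_eq_volume,
    inter_comm A, ← image_inter_preimage, ← hK2, inter_comm _ S]
  have himg : S ∩ planeCoord e ⁻¹' A = Function.invFunOn (planeCoord e) S ''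
      (planeCoord e '' (S ∩ planeCoord e ⁻¹' A)) := by
    rw [(hS.leftInvOn_invFunOn.mono inter_subset_left).image_image]
  conv_lhs => rw [himg]
  exact (hlip.mono (image_mono inter_subset_left)).euclideanHausdorffMeasure_image_le 2

include he hX in
theorem integral_liftedValue_le
    (hwi : IntegrableOn w (frontier M ∩ ball p r) μHE[2])
    (hw : ∀ x ∈ frontier M ∩ ball p r, 0 ≤ w x)
    (hli : Integrable (liftedValue e (frontier M ∩ ball p r) w)) :
    0 ≤ ∫ y, liftedValue e (frontier M ∩ ball p r) w y ∧
    ∫ y, liftedValue e (frontier M ∩ ball p r) w y ≤ ∫ x in frontier M ∩ ball p r, w x ∂μHE[2] := by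
  set S := frontier M ∩ ball p r with hSdef
  have hS := injOn_planeCoord he hX
  have hSm : MeasurableSet S := isClosed_frontier.measurableSet.inter measurableSet_ball
  have hnn : ∀ y, 0 ≤ liftedValue e S w y := by
    intro y
    by_cases hy : y ∈ planeCoord e '' S
    · obtain ⟨x, hx, rfl⟩ := hy
      rw [liftedValue_planeCoord hS hx]; exact hw x hx
    · rw [liftedValue, indicator_of_notMem hy]
  have hwn : 0 ≤ᵐ[μHE[2].restrict S] w := (ae_restrict_iff' hSm).2 (.of_forall hw)
  refine ⟨integral_nonneg hnn, ?_⟩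
  rw [integral_eq_lintegral_of_nonneg_ae (.of_forall hnn) hli.1,
    integral_eq_lintegral_of_nonneg_ae hwn hwi.1]
  refine ENNReal.toReal_mono hwi.lintegral_lt_top.ne ?_
  calc ∫⁻ y, ENNReal.ofReal (liftedValue e S w y)
      = ∫⁻ y in planeCoord e '' S, ENNReal.ofReal (liftedValue e S w y) := by
        rw [← lintegral_indicator (measurableSet_planeCoord_image hSm hS)]
        refine lintegral_congr fun y => ?_
        by_cases hy : y ∈ planeCoord e '' S
        · rw [indicator_of_mem hy]
        · rw [indicator_of_notMem hy, liftedValue, indicator_of_notMem hy, ENNReal.ofReal_zero]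
    _ ≤ ∫⁻ y, ENNReal.ofReal (liftedValue e S w y) ∂(μHE[2].restrict S).map (planeCoord e) :=
        lintegral_mono' (restrict_image_le_map_planeCoord S) le_rfl
    _ ≤ ∫⁻ x in S, ENNReal.ofReal (liftedValue e S w (planeCoord e x)) ∂μHE[2] :=
        lintegral_map_le _ _
    _ = ∫⁻ x in S, ENNReal.ofReal (w x) ∂μHE[2] :=
        setLIntegral_congr_fun hSm fun x hx => by rw [liftedValue_planeCoord hS hx]

include he hX in
theorem le_integral_liftedValue
    (hwi : IntegrableOn w (frontier M ∩ ball p r) μHE[2])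
    (hw : ∀ x ∈ frontier M ∩ ball p r, 0 ≤ w x)
    (hli : Integrable (liftedValue e (frontier M ∩ ball p r) w))
    {η : ℝ} (hη0 : 0 ≤ η) (hη1 : η < 1) (hη : ∀ x ∈ frontier M ∩ ball p r,
      ∀ x' ∈ frontier M ∩ ball p r, |inner ℝ d (x - x')| ≤ η * ‖x - x'‖) :
    (1 - η ^ 2) * ∫ x in frontier M ∩ ball p r, w x ∂μHE[2] ≤
      ∫ y, liftedValue e (frontier M ∩ ball p r) w y := by
  set S := frontier M ∩ ball p r with hSdef
  have hS := injOn_planeCoord he hX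
  have hSm : MeasurableSet S := isClosed_frontier.measurableSet.inter measurableSet_ball
  have hpos : 0 < 1 - η ^ 2 := by nlinarith
  have hnn : ∀ y, 0 ≤ liftedValue e S w y := by
    intro y
    by_cases hy : y ∈ planeCoord e '' S
    · obtain ⟨x, hx, rfl⟩ := hy
      rw [liftedValue_planeCoord hS hx]; exact hw x hx
    · rw [liftedValue, indicator_of_notMem hy]
  have hwn : 0 ≤ᵐ[μHE[2].restrict S] w := (ae_restrict_iff' hSm).2 (.of_forall hw)
  simp_rw [← symm_snd_eq_inner he] at hη
  have hmap := map_planeCoord_le_restrict_image hS hη0 hη1 hη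
  -- The lifted value is only known to be a.e. measurable for Lebesgue measure; absolute continuity
  -- carries this over to the projected area measure.
  have hac : (μHE[2].restrict S).map (planeCoord e) ≪ volume :=
    (Measure.absolutelyContinuous_of_le hmap).trans
      ((Measure.AbsolutelyContinuous.smul_left Measure.restrict_le_self.absolutelyContinuous _))
  have key : ∫⁻ x in S, ENNReal.ofReal (w x) ∂μHE[2] ≤
      ENNReal.ofReal (1 - η ^ 2)⁻¹ * ∫⁻ y, ENNReal.ofReal (liftedValue e S w y) :=
    calc ∫⁻ x in S, ENNReal.ofReal (w x) ∂μHE[2]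
        = ∫⁻ x in S, ENNReal.ofReal (liftedValue e S w (planeCoord e x)) ∂μHE[2] :=
          setLIntegral_congr_fun hSm fun x hx => by rw [liftedValue_planeCoord hS hx]
      _ = ∫⁻ y, ENNReal.ofReal (liftedValue e S w y) ∂(μHE[2].restrict S).map (planeCoord e) :=
          (lintegral_map' (hli.1.aemeasurable.ennreal_ofReal.mono_ac hac)
            (lipschitzWith_planeCoord e).continuous.aemeasurable).symm
      _ ≤ ∫⁻ y, ENNReal.ofReal (liftedValue e S w y) ∂(ENNReal.ofReal (1 - η ^ 2)⁻¹ • volume) :=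
          lintegral_mono' (hmap.trans (by gcongr; exact Measure.restrict_le_self)) le_rfl
      _ = _ := lintegral_smul_measure _ _
  rw [integral_eq_lintegral_of_nonneg_ae (.of_forall hnn) hli.1,
    integral_eq_lintegral_of_nonneg_ae hwn hwi.1]
  have h2 := ENNReal.toReal_mono
    (ENNReal.mul_ne_top ENNReal.ofReal_ne_top hli.lintegral_lt_top.ne) key
  rw [ENNReal.toReal_mul, ENNReal.toReal_ofReal (inv_pos.2 hpos).le, inv_mul_eq_div,
    le_div_iff₀ hpos] at h2
  linarith

end Flux

/-! ### Local structure of the regular boundary. -/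

section RegularBoundary

open Set Metric Filter Topology

variable {M : Set R3}

theorem outwardNormal_eq {x n : R3} (h : IsOutwardUnitNormal M x n) : outwardNormal M x = n :=
  isOutwardUnitNormal_unique (isOutwardUnitNormal_outwardNormal ⟨n, h⟩) h

theorem outwardNormal_of_notMem {x : R3} (h : x ∉ regularBoundary M) : outwardNormal M x = 0 :=
  dif_neg h

theorem GeometricCalculus.IsOutwardUnitNormal.norm_eq_one {x n : R3} (h : IsOutwardUnitNormal M x n) : ‖n‖ = 1 := by
  obtain ⟨-, U, f, -, -, -, hg, -, rfl⟩ := h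
  rw [norm_smul, norm_inv, norm_norm, inv_mul_cancel₀ (norm_ne_zero_iff.2 hg)]

theorem norm_outwardNormal_le_one (M : Set R3) (x : R3) : ‖outwardNormal M x‖ ≤ 1 := by
  by_cases h : x ∈ regularBoundary M
  · exact (isOutwardUnitNormal_outwardNormal h).norm_eq_one.le
  · simp [outwardNormal_of_notMem h]

theorem abs_inner_outwardNormal_le (M : Set R3) (x e : R3) :
    |inner ℝ (outwardNormal M x) e| ≤ ‖e‖ :=
  (abs_real_inner_le_norm _ _).trans
    (mul_le_of_le_one_left (norm_nonneg _) (norm_outwardNormal_le_one M x))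

theorem ContDiffOn.continuousOn_gradient {U : Set R3} {f : R3 → ℝ} (hU : IsOpen U)
    (hf : ContDiffOn ℝ 1 f U) : ContinuousOn (gradient f) U :=
  (InnerProductSpace.toDual ℝ R3).symm.continuous.comp_continuousOn
    (hf.continuousOn_fderiv_of_isOpen hU le_rfl)

/-- Near a regular boundary point all boundary points are regular, and the normal is close to the
normal at the given point. -/
theorem eventually_regular_and_normal_near {p : R3} (hp : p ∈ regularBoundary M) {ε : ℝ}
    (hε : 0 < ε) : ∀ᶠ x in 𝓝 p, x ∈ frontier M →
      x ∈ regularBoundary M ∧ ‖outwardNormal M x - outwardNormal M p‖ < ε := by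
  obtain ⟨n, hn⟩ := hp
  rw [outwardNormal_eq hn]
  obtain ⟨hpf, U, f, hU, hpU, hf, hg, hfM, rfl⟩ := hn
  have hgc : ContinuousAt (gradient f) p :=
    (hf.continuousOn_gradient hU).continuousAt (hU.mem_nhds hpU)
  have hnc : ContinuousAt (fun x => ‖gradient f x‖⁻¹ • gradient f x) p :=
    (hgc.norm.inv₀ (norm_ne_zero_iff.2 hg)).smul hgc
  filter_upwards [hU.mem_nhds hpU, hgc.eventually_ne hg,
    Metric.tendsto_nhds.1 hnc.tendsto ε hε] with x hxU hxg hxn hxf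
  have hx : IsOutwardUnitNormal M x (‖gradient f x‖⁻¹ • gradient f x) :=
    ⟨hxf, U, f, hU, hxU, hf, hxg, hfM, rfl⟩
  refine ⟨⟨_, hx⟩, ?_⟩
  rwa [outwardNormal_eq hx, ← dist_eq_norm]

theorem regularBoundary_subset_frontier : regularBoundary M ⊆ frontier M := fun _ ⟨_, h⟩ => h.1

/-- The same defining function serves all nearby frontier points, so regularity is relatively open
in the frontier. -/
theorem isClosed_singularBoundary : IsClosed (frontier M \ regularBoundary M) := by
  rw [← isOpen_compl_iff, isOpen_iff_mem_nhds]
  intro p hp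
  by_cases hpf : p ∈ frontier M
  · have hpr : p ∈ regularBoundary M := by
      by_contra h; exact hp ⟨hpf, h⟩
    filter_upwards [eventually_regular_and_normal_near hpr one_pos] with x hx hxS
    exact hxS.2 (hx hxS.1).1
  · filter_upwards [isClosed_frontier.isOpen_compl.mem_nhds hpf] with x hx hxS
    exact hx hxS.1

theorem measurable_outwardNormal : Measurable (outwardNormal M) := by
  have hm : MeasurableSet (regularBoundary M) := by
    rw [← sdiff_sdiff_cancel_left (regularBoundary_subset_frontier (M := M))]
    exact isClosed_frontier.measurableSet.diff isClosed_singularBoundary.measurableSet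
  have hc : ContinuousOn (outwardNormal M) (regularBoundary M) := by
    intro p hp
    refine Metric.tendsto_nhds.2 fun ε hε => ?_
    filter_upwards [mem_nhdsWithin_of_mem_nhds (eventually_regular_and_normal_near hp hε),
      self_mem_nhdsWithin] with x hx hxr
    rw [dist_eq_norm]
    exact (hx (regularBoundary_subset_frontier hxr)).2
  classical
  have h0 : outwardNormal M = (regularBoundary M).piecewise (outwardNormal M) fun _ => 0 := by
    ext1 x
    by_cases hx : x ∈ regularBoundary M
    · rw [piecewise_eq_of_mem _ _ _ hx]
    · rw [piecewise_eq_of_notMem _ _ _ hx, outwardNormal_of_notMem hx]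
  rw [h0]
  exact hc.measurable_piecewise continuousOn_const hm

/-- Strict differentiability makes the defining function uniformly close to the linear map `c ⟪n,
·⟫` on differences of points of a ball. It therefore increases in every direction of the cone `η ‖d‖
< ⟪n, d⟫`, which gives transversality; and as it is zero on the frontier, frontier chords are nearly
orthogonal to `n`. -/
theorem exists_ball_exitsAlong {p n : R3} (hn : IsOutwardUnitNormal M p n) {η : ℝ} (hη : 0 < η) :
    ∃ r > 0, (∀ d : R3, η * ‖d‖ < inner ℝ n d → ExitsAlong M p r d) ∧
      ∀ x ∈ frontier M ∩ ball p r, ∀ x' ∈ frontier M ∩ ball p r,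
        |inner ℝ n (x - x')| ≤ η * ‖x - x'‖ := by
  obtain ⟨hpf, U, f, hU, hpU, hf, hg, hfM, hneq⟩ := hn
  set c := ‖gradient f p‖ with hc
  have hc0 : 0 < c := norm_pos_iff.2 hg
  have hgn : gradient f p = c • n := by rw [hneq, smul_inv_smul₀ hc0.ne']
  have hs : HasStrictFDerivAt f (fderiv ℝ f p) p :=
    (hf.contDiffAt (hU.mem_nhds hpU)).hasStrictFDerivAt (by norm_num)
  -- The tolerance is scaled by the gradient norm `c`, so that `c` cancels from both conclusions.
  obtain ⟨s, hs, happ⟩ := hs.approximates_deriv_on_nhds (c := Real.toNNReal (η * c))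
    (Or.inr (Real.toNNReal_pos.2 (by positivity)))
  obtain ⟨r, hr, hrs⟩ := Metric.mem_nhds_iff.1 (inter_mem hs (hU.mem_nhds hpU))
  have hfd : ∀ v, fderiv ℝ f p v = c * inner ℝ n v := fun v => by
    have : inner ℝ (gradient f p) v = fderiv ℝ f p v := by
      rw [gradient, InnerProductSpace.toDual_symm_apply]
    rw [← this, hgn, real_inner_smul_left]
  have key : ∀ x ∈ ball p r, ∀ x' ∈ ball p r,
      |f x - f x' - c * inner ℝ n (x - x')| ≤ η * c * ‖x - x'‖ := by
    intro x hx x' hx'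
    have := happ x (hrs hx).1 x' (hrs hx').1
    rwa [hfd, Real.norm_eq_abs, Real.coe_toNNReal _ (by positivity)] at this
  have hzero : ∀ x ∈ frontier M ∩ ball p r, f x = 0 := fun x hx =>
    eq_zero_of_defining hx.1 hU (hrs hx.2).2 hf hfM
  refine ⟨r, hr, fun d hd x hx s hs => ⟨fun hb => ?_, fun hb hM => ?_⟩, fun x hx x' hx' => ?_⟩
  · have h1 := key x hx.2 _ hb
    rw [hzero x hx, sub_sub_cancel, real_inner_smul_right, norm_smul, Real.norm_of_nonneg hs.le,
      abs_le] at h1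
    have h2 : f (x - s • d) < 0 := by
      have := mul_lt_mul_of_pos_left hd (mul_pos hc0 hs)
      nlinarith [h1.2]
    have hcont : ContinuousAt f (x - s • d) :=
      (hf.continuousOn).continuousAt (hU.mem_nhds (hrs hb).2)
    rw [mem_interior_iff_mem_nhds]
    filter_upwards [hcont.eventually (gt_mem_nhds h2), hU.mem_nhds (hrs hb).2] with z hz hzU
    exact (hfM z hzU).2 hz.le
  · have h1 := key _ hb x hx.2
    rw [hzero x hx, add_sub_cancel_left, real_inner_smul_right, norm_smul,
      Real.norm_of_nonneg hs.le, abs_le] at h1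
    have := mul_lt_mul_of_pos_left hd (mul_pos hc0 hs)
    have h3 := (hfM _ (hrs hb).2).1 hM
    nlinarith [h1.1]
  · have h1 := key x hx.2 x' hx'.2
    rw [hzero x hx, hzero x' hx', sub_self, zero_sub, abs_neg, abs_mul, abs_of_pos hc0] at h1
    nlinarith [h1]

end RegularBoundary

/-! ### Integrability, and the local flux estimate at a regular point. -/

section BoundedDeriv

open Set Metric

/-- The function is continuous on `M` and differentiable with bounded derivative in the interior of
`M`. -/
structure HasBoundedDerivOn (M : Set R3) (w : R3 → ℝ) : Prop where
  continuousOn : ContinuousOn w M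
  differentiableOn : DifferentiableOn ℝ w (interior M)
  exists_norm_fderiv_le : ∃ C, ∀ x ∈ interior M, ‖fderiv ℝ w x‖ ≤ C

namespace HasBoundedDerivOn

variable {M : Set R3} {w χ : R3 → ℝ}

theorem differentiableAt (hw : HasBoundedDerivOn M w) {x : R3} (hx : x ∈ interior M) :
    DifferentiableAt ℝ w x :=
  hw.differentiableOn.differentiableAt (isOpen_interior.mem_nhds hx)

theorem exists_abs_le (hM : IsCompact M) (hw : HasBoundedDerivOn M w) :
    ∃ C, 0 ≤ C ∧ ∀ x ∈ M, |w x| ≤ C := by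
  obtain ⟨C, hC⟩ := hM.exists_bound_of_continuousOn hw.continuousOn
  exact ⟨max C 0, le_max_right _ _, fun x hx => (hC x hx).trans (le_max_left _ _)⟩

theorem const (c : ℝ) : HasBoundedDerivOn M fun _ => c :=
  ⟨continuousOn_const, differentiableOn_const c, 0, fun x _ => by simp⟩

theorem of_contDiff (hM : IsCompact M) (hχ : ContDiff ℝ 1 χ) : HasBoundedDerivOn M χ := by
  refine ⟨hχ.continuous.continuousOn, (hχ.differentiable (by norm_num)).differentiableOn, ?_⟩
  obtain ⟨C, hC⟩ := hM.exists_bound_of_continuousOn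
    (hχ.continuous_fderiv (by norm_num)).continuousOn
  exact ⟨C, fun x hx => hC x (interior_subset hx)⟩

theorem fderiv_mul_apply (hχ : HasBoundedDerivOn M χ) (hw : HasBoundedDerivOn M w) {x : R3}
    (hx : x ∈ interior M) (e : R3) :
    fderiv ℝ (fun x => χ x * w x) x e = χ x * fderiv ℝ w x e + w x * fderiv ℝ χ x e := by
  rw [fderiv_fun_mul (hχ.differentiableAt hx) (hw.differentiableAt hx)]
  simp

theorem add (hχ : HasBoundedDerivOn M χ) (hw : HasBoundedDerivOn M w) :
    HasBoundedDerivOn M fun x => χ x + w x := by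
  refine ⟨hχ.continuousOn.add hw.continuousOn, hχ.differentiableOn.add hw.differentiableOn, ?_⟩
  obtain ⟨C, hC⟩ := hχ.exists_norm_fderiv_le
  obtain ⟨D, hD⟩ := hw.exists_norm_fderiv_le
  refine ⟨C + D, fun x hx => ?_⟩
  rw [fderiv_fun_add (hχ.differentiableAt hx) (hw.differentiableAt hx)]
  exact (norm_add_le _ _).trans (add_le_add (hC x hx) (hD x hx))

theorem mul (hM : IsCompact M) (hχ : HasBoundedDerivOn M χ) (hw : HasBoundedDerivOn M w) :
    HasBoundedDerivOn M fun x => χ x * w x := by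
  refine ⟨hχ.continuousOn.mul hw.continuousOn, hχ.differentiableOn.mul hw.differentiableOn, ?_⟩
  obtain ⟨C, hC⟩ := hχ.exists_norm_fderiv_le
  obtain ⟨D, hD⟩ := hw.exists_norm_fderiv_le
  obtain ⟨A, hA0, hA⟩ := hχ.exists_abs_le hM
  obtain ⟨B, hB0, hB⟩ := hw.exists_abs_le hM
  refine ⟨A * D + B * C, fun x hx => ?_⟩
  rw [fderiv_fun_mul (hχ.differentiableAt hx) (hw.differentiableAt hx)]
  refine (norm_add_le _ _).trans (add_le_add ?_ ?_)
  · rw [norm_smul]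
    exact mul_le_mul (hA x (interior_subset hx)) (hD x hx) (norm_nonneg _) hA0
  · rw [norm_smul]
    exact mul_le_mul (hB x (interior_subset hx)) (hC x hx) (norm_nonneg _) hB0

theorem integrableOn_fderiv (hM : IsCompact M) (hw : HasBoundedDerivOn M w) (e : R3) :
    IntegrableOn (fun x => fderiv ℝ w x e) (interior M) := by
  obtain ⟨C, hC⟩ := hw.exists_norm_fderiv_le
  refine Measure.integrableOn_of_bounded (M := C * ‖e‖)
    ((measure_mono interior_subset).trans_lt hM.measure_lt_top).ne
    (measurable_fderiv_apply_const ℝ w e).aestronglyMeasurable ?_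
  filter_upwards [ae_restrict_mem isOpen_interior.measurableSet] with x hx
  exact (ContinuousLinearMap.le_opNorm _ _).trans (by gcongr; exact hC x hx)

theorem aestronglyMeasurable_frontier (hM : IsClosed M) (hw : HasBoundedDerivOn M w) :
    AEStronglyMeasurable w (μHE[2].restrict (frontier M)) :=
  (hw.continuousOn.mono hM.frontier_subset).aestronglyMeasurable isClosed_frontier.measurableSet

theorem integrableOn_frontier (hM : IsCompact M) (harea : μHE[2] (frontier M) < ⊤)
    (hw : HasBoundedDerivOn M w) : IntegrableOn w (frontier M) μHE[2] := by
  obtain ⟨C, -, hC⟩ := hw.exists_abs_le hM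
  have : IsFiniteMeasure (μHE[2].restrict (frontier M)) := ⟨by simpa using harea⟩
  refine Integrable.of_bound (hw.aestronglyMeasurable_frontier hM.isClosed) C ?_
  filter_upwards [ae_restrict_mem isClosed_frontier.measurableSet] with x hx
  exact hC x (hM.isClosed.frontier_subset hx)

theorem integrableOn_mul_normal (hM : IsCompact M) (harea : μHE[2] (frontier M) < ⊤)
    (hw : HasBoundedDerivOn M w) (e : R3) :
    IntegrableOn (fun x => w x * inner ℝ (outwardNormal M x) e) (frontier M) μHE[2] := by
  refine (hw.integrableOn_frontier hM harea).mul_bdd (c := ‖e‖) ?_ ?_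
  · exact (measurable_outwardNormal.inner measurable_const).aestronglyMeasurable
  · exact .of_forall fun x => abs_inner_outwardNormal_le M x e

end HasBoundedDerivOn

variable {M : Set R3} {w : R3 → ℝ}

theorem ExitsAlong.smul {p : R3} {r : ℝ} {d : R3} (h : ExitsAlong M p r d) {c : ℝ} (hc : 0 < c) :
    ExitsAlong M p r (c • d) := fun x hx s hs => by
  rw [smul_smul]; exact h x hx _ (mul_pos hs hc)

/-- The shadow of the boundary piece has no more area than the piece itself. The factor `‖d‖` comes
from normalizing `d`; keeping `d` general allows linearity in `d` to be exploited later. -/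
theorem flux_le_of_exitsAlong (hM : IsCompact M) (harea : μHE[2] (frontier M) < ⊤)
    (hw : HasBoundedDerivOn M w) {p : R3} {r : ℝ} (hw0 : ∀ x ∈ M \ ball p r, w x = 0)
    (hnn : ∀ x ∈ M, 0 ≤ w x) {d : R3} (hd : d ≠ 0) (hX : ExitsAlong M p r d) :
    ∫ x in interior M ∩ ball p r, fderiv ℝ w x d ≤
      ‖d‖ * ∫ x in frontier M ∩ ball p r, w x ∂μHE[2] := by
  have hd0 : 0 < ‖d‖ := norm_pos_iff.2 hd
  set u := ‖d‖⁻¹ • d with hu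
  have hu1 : ‖u‖ = 1 := norm_smul_inv_norm hd
  have hdu : d = ‖d‖ • u := (smul_inv_smul₀ hd0.ne' d).symm
  have hXu : ExitsAlong M p r u := hX.smul (inv_pos.2 hd0)
  obtain ⟨e, he⟩ := exists_linearIsometryEquiv_snd_eq hu1
  obtain ⟨h1, h2⟩ := integral_fderiv_eq_integral_liftedValue he hXu hM.isClosed hw.continuousOn
    hw.differentiableOn hw0 ((hw.integrableOn_fderiv hM u).mono_set inter_subset_left)
  have h3 := (integral_liftedValue_le he hXu
    ((hw.integrableOn_frontier hM harea).mono_set inter_subset_left)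
    (fun x hx => hnn x (hM.isClosed.frontier_subset hx.1)) h1).2
  have h4 : ∫ x in interior M ∩ ball p r, fderiv ℝ w x d =
      ‖d‖ * ∫ x in interior M ∩ ball p r, fderiv ℝ w x u := by
    rw [← integral_const_mul]
    conv_lhs => rw [hdu]
    simp only [map_smul, smul_eq_mul]
  rw [h4, h2]
  gcongr

/-- Along the normal of a nearly flat piece the projection loses little area, so the upper bound is
almost attained. -/
theorem le_flux_of_exitsAlong (hM : IsCompact M) (harea : μHE[2] (frontier M) < ⊤)
    (hw : HasBoundedDerivOn M w) {p : R3} {r : ℝ} (hw0 : ∀ x ∈ M \ ball p r, w x = 0)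
    (hnn : ∀ x ∈ M, 0 ≤ w x) {n : R3} (hn : ‖n‖ = 1) (hX : ExitsAlong M p r n)
    {η : ℝ} (hη0 : 0 ≤ η) (hη1 : η < 1) (hη : ∀ x ∈ frontier M ∩ ball p r,
      ∀ x' ∈ frontier M ∩ ball p r, |inner ℝ n (x - x')| ≤ η * ‖x - x'‖) :
    (1 - η ^ 2) * ∫ x in frontier M ∩ ball p r, w x ∂μHE[2] ≤
      ∫ x in interior M ∩ ball p r, fderiv ℝ w x n := by
  obtain ⟨e, he⟩ := exists_linearIsometryEquiv_snd_eq hn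
  obtain ⟨h1, h2⟩ := integral_fderiv_eq_integral_liftedValue he hX hM.isClosed hw.continuousOn
    hw.differentiableOn hw0 ((hw.integrableOn_fderiv hM n).mono_set inter_subset_left)
  rw [h2]
  exact le_integral_liftedValue he hX
    ((hw.integrableOn_frontier hM harea).mono_set inter_subset_left)
    (fun x hx => hnn x (hM.isClosed.frontier_subset hx.1)) h1 hη0 hη1 hη

/-- The flux through a small piece of the boundary is, up to a small relative error, the flux
through its tangent plane. -/
theorem exists_ball_flux_near_tangent (hM : IsCompact M) (harea : μHE[2] (frontier M) < ⊤)
    {p n : R3} (hn : IsOutwardUnitNormal M p n) {ε : ℝ} (hε : 0 < ε) :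
    ∃ r > 0, ∀ ρ ≤ r, ∀ w, HasBoundedDerivOn M w → (∀ x ∈ M \ ball p ρ, w x = 0) →
      (∀ x ∈ M, 0 ≤ w x) → ∀ e : R3, ‖e‖ ≤ 1 →
        |(∫ x in interior M ∩ ball p ρ, fderiv ℝ w x e) -
          inner ℝ n e * ∫ x in frontier M ∩ ball p ρ, w x ∂μHE[2]| ≤
          ε * ∫ x in frontier M ∩ ball p ρ, w x ∂μHE[2] := by
  -- The final error is `3/2 * η`, which `ε / 2` keeps below `ε`; the bound `1 / 3` keeps `n + η •
  -- e` inside the cone of transversal directions.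
  set η := min (ε / 2) (1 / 3) with hηdef
  have hη0 : 0 < η := lt_min (by positivity) (by norm_num)
  have hη1 : η ≤ 1 / 3 := min_le_right _ _
  have hηε : η ≤ ε / 2 := min_le_left _ _
  have hn1 := hn.norm_eq_one
  obtain ⟨r, hr, hexit, hflat⟩ := exists_ball_exitsAlong hn hη0
  refine ⟨r, hr, fun ρ hρ w hw hw0 hnn e he => ?_⟩
  have hsub : frontier M ∩ ball p ρ ⊆ frontier M ∩ ball p r :=
    inter_subset_inter_right _ (ball_subset_ball hρ)
  have hexit' : ∀ d : R3, η * ‖d‖ < inner ℝ n d → ExitsAlong M p ρ d := fun d hd x hx s hs =>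
    ⟨fun h => (hexit d hd x (hsub hx) s hs).1 (ball_subset_ball hρ h),
      fun h => (hexit d hd x (hsub hx) s hs).2 (ball_subset_ball hρ h)⟩
  set W := ∫ x in frontier M ∩ ball p ρ, w x ∂μHE[2]
  have hW : 0 ≤ W := setIntegral_nonneg
    (isClosed_frontier.measurableSet.inter measurableSet_ball)
    fun x hx => hnn x (hM.isClosed.frontier_subset hx.1)
  set L : R3 → ℝ := fun e => ∫ x in interior M ∩ ball p ρ, fderiv ℝ w x e with hL
  have hLi : ∀ e, IntegrableOn (fun x => fderiv ℝ w x e) (interior M ∩ ball p ρ) := fun e =>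
    (hw.integrableOn_fderiv hM e).mono_set inter_subset_left
  have hLn : (1 - η ^ 2) * W ≤ L n :=
    le_flux_of_exitsAlong hM harea hw hw0 hnn hn1
      (hexit' n (by rw [hn1, real_inner_self_eq_norm_sq, hn1]; linarith)) hη0.le (by linarith)
      fun x hx x' hx' => hflat x (hsub hx) x' (hsub hx')
  -- `L` is linear with `L d ≤ ‖d‖ W` at `d = n + η e` and `L n ≥ (1 - η²) W`. Subtracting and
  -- dividing by `η` gives `L e ≤ ⟪n, e⟫ W` up to a multiple of `η W`, because the norm has
  -- derivative `⟪n, ·⟫` at `n`.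
  have key : ∀ e : R3, ‖e‖ ≤ 1 → L e ≤ (inner ℝ n e + ε) * W := by
    intro e he
    set d := n + η • e
    have hne : |inner ℝ n e| ≤ 1 := (abs_real_inner_le_norm _ _).trans (by rw [hn1]; linarith)
    obtain ⟨hne1, hne2⟩ := abs_le.1 hne
    have hnd : inner ℝ n d = 1 + η * inner ℝ n e := by
      rw [inner_add_right, real_inner_smul_right, real_inner_self_eq_norm_sq, hn1]; ring
    have hdsq : ‖d‖ ^ 2 ≤ 1 + 2 * η * inner ℝ n e + η ^ 2 := by
      rw [norm_add_sq_real, real_inner_smul_right, norm_smul, hn1, Real.norm_of_nonneg hη0.le,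
        mul_pow]
      nlinarith [norm_nonneg e, mul_nonneg (sq_nonneg η) (norm_nonneg e),
        mul_le_mul_of_nonneg_left (pow_le_one₀ (norm_nonneg e) he (n := 2)) (sq_nonneg η)]
    -- From `‖d‖ ≤ (1 + ‖d‖²) / 2`.
    have hd1 : ‖d‖ ≤ 1 + η * inner ℝ n e + η ^ 2 / 2 := by
      nlinarith [sq_nonneg (‖d‖ - 1), norm_nonneg d]
    have hlt : η * ‖d‖ < inner ℝ n d := by rw [hnd]; nlinarith
    have hdne : d ≠ 0 := by
      intro h
      rw [h, norm_zero, inner_zero_right, mul_zero] at hlt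
      exact lt_irrefl _ hlt
    have h1 : L d ≤ ‖d‖ * W := flux_le_of_exitsAlong hM harea hw hw0 hnn hdne (hexit' d hlt)
    have h2 : L d = L n + η * L e := by
      simp only [hL, d, map_add, map_smul, smul_eq_mul]
      rw [integral_add (hLi n) ((hLi e).const_mul η), integral_const_mul]
    have h3 : η * L e ≤ η * ((inner ℝ n e + 3 / 2 * η) * W) := by nlinarith
    have h4 := le_of_mul_le_mul_left h3 hη0
    nlinarith
  have h1 := key e he
  -- Linearity of `L` turns the upper bound at `-e` into the lower bound at `e`.
  have h2 := key (-e) (by rwa [norm_neg])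
  have h3 : L (-e) = -L e := by simp only [hL, map_neg, integral_neg]
  rw [h3, inner_neg_right] at h2
  rw [abs_le]
  constructor <;> nlinarith

end BoundedDeriv

/-! ### From local flux estimates to the region: partition of unity. -/

section GlobalFlux

open Set Metric Filter Topology

variable {M : Set R3}

/-- At a regular point, half of `ε` pays for the tangent-plane estimate and half for replacing the
fixed normal at `p` by the varying one. At an interior point both fluxes vanish. -/
theorem exists_ball_flux_near_boundaryFlux (hM : IsCompact M) (harea : μHE[2] (frontier M) < ⊤)
    {p : R3} (hp : p ∈ M) (hps : p ∉ frontier M \ regularBoundary M) {ε : ℝ} (hε : 0 < ε) :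
    ∃ r > 0, ∀ w, HasBoundedDerivOn M w → (∀ x ∈ M \ ball p r, w x = 0) →
      (∀ x ∈ M, 0 ≤ w x) → ∀ e : R3, ‖e‖ ≤ 1 →
        |(∫ x in interior M ∩ ball p r, fderiv ℝ w x e) -
          ∫ x in frontier M ∩ ball p r, w x * inner ℝ (outwardNormal M x) e ∂μHE[2]| ≤
          ε * ∫ x in frontier M ∩ ball p r, w x ∂μHE[2] := by
  by_cases hpi : p ∈ interior M
  · obtain ⟨r, hr, hrM⟩ := Metric.isOpen_iff.1 isOpen_interior p hpi
    refine ⟨r, hr, fun w hw hw0 hnn e _ => ?_⟩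
    have hempty : frontier M ∩ ball p r = ∅ := by
      ext x; simp only [mem_inter_iff, mem_empty_iff_false, iff_false]
      exact fun hx => hx.1.2 (hrM hx.2)
    -- The ball contains no frontier, so every direction is vacuously transversal and the bound by
    -- boundary mass is zero; using `e` and `-e` gives equality.
    have hle : ∀ d : R3, ∫ x in interior M ∩ ball p r, fderiv ℝ w x d ≤ 0 := by
      intro d
      rcases eq_or_ne d 0 with rfl | hd
      · simp
      · have := flux_le_of_exitsAlong hM harea hw hw0 hnn hd
          (fun x hx => absurd hx (hempty ▸ notMem_empty x))
        simpa [hempty] using this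
    have h1 := hle e
    have h2 := hle (-e)
    simp only [map_neg, integral_neg] at h2
    rw [le_antisymm h1 (by linarith), hempty]
    simp
  · have hpr : p ∈ regularBoundary M := by
      by_contra h; exact hps ⟨⟨subset_closure hp, hpi⟩, h⟩
    have hn := isOutwardUnitNormal_outwardNormal hpr
    obtain ⟨r₁, hr₁, h₁⟩ := exists_ball_flux_near_tangent hM harea hn (half_pos hε)
    obtain ⟨r₂, hr₂, h₂⟩ := Metric.eventually_nhds_iff_ball.1
      (eventually_regular_and_normal_near hpr (half_pos hε))
    refine ⟨min r₁ r₂, lt_min hr₁ hr₂, fun w hw hw0 hnn e he => ?_⟩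
    set r := min r₁ r₂
    have h3 := h₁ r (min_le_left _ _) w hw hw0 hnn e he
    set S := frontier M ∩ ball p r with hS
    have hSm : MeasurableSet S := isClosed_frontier.measurableSet.inter measurableSet_ball
    have hi1 : IntegrableOn w S μHE[2] :=
      (hw.integrableOn_frontier hM harea).mono_set inter_subset_left
    have hi2 : IntegrableOn (fun x => w x * inner ℝ (outwardNormal M x) e) S μHE[2] :=
      (hw.integrableOn_mul_normal hM harea e).mono_set inter_subset_left
    have h4 : |inner ℝ (outwardNormal M p) e * (∫ x in S, w x ∂μHE[2]) -
        ∫ x in S, w x * inner ℝ (outwardNormal M x) e ∂μHE[2]| ≤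
        ε / 2 * ∫ x in S, w x ∂μHE[2] := by
      rw [← integral_const_mul, ← integral_sub (hi1.const_mul _) hi2, ← integral_const_mul,
        ← Real.norm_eq_abs]
      refine norm_integral_le_of_norm_le (hi1.const_mul _) ?_
      filter_upwards [ae_restrict_mem hSm] with x hx
      have hx0 := hnn x (hM.isClosed.frontier_subset hx.1)
      have h5 := (h₂ x (ball_subset_ball (min_le_right _ _) hx.2) hx.1).2
      have h6 : inner ℝ (outwardNormal M p) e * w x - w x * inner ℝ (outwardNormal M x) e =
          w x * inner ℝ (outwardNormal M p - outwardNormal M x) e := by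
        rw [inner_sub_left]; ring
      rw [h6, norm_mul, Real.norm_of_nonneg hx0, mul_comm (ε / 2)]
      gcongr
      refine (norm_inner_le_norm _ _).trans ?_
      rw [norm_sub_rev]
      nlinarith [norm_nonneg (outwardNormal M x - outwardNormal M p), norm_nonneg e]
    have := abs_sub_le (∫ x in interior M ∩ ball p r, fderiv ℝ w x e)
      (inner ℝ (outwardNormal M p) e * (∫ x in S, w x ∂μHE[2]))
      (∫ x in S, w x * inner ℝ (outwardNormal M x) e ∂μHE[2])
    linarith

/-- The difference of the two sides of the divergence theorem for the field `w • e`. -/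
noncomputable def fluxDefect (M : Set R3) (e : R3) (w : R3 → ℝ) : ℝ :=
  (∫ x in interior M, fderiv ℝ w x e) -
    ∫ x in frontier M, w x * inner ℝ (outwardNormal M x) e ∂μHE[2]

theorem fderiv_eq_of_eqOn_interior {w w' : R3 → ℝ} (h : EqOn w w' M) {x : R3}
    (hx : x ∈ interior M) : fderiv ℝ w x = fderiv ℝ w' x :=
  Filter.EventuallyEq.fderiv_eq (by
    filter_upwards [isOpen_interior.mem_nhds hx] with y hy
    exact h (interior_subset hy))

theorem fluxDefect_congr (hM : IsClosed M) {w w' : R3 → ℝ} (h : EqOn w w' M) (e : R3) :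
    fluxDefect M e w = fluxDefect M e w' := by
  unfold fluxDefect
  congr 1
  · exact setIntegral_congr_fun isOpen_interior.measurableSet fun x hx => by
      simp only [fderiv_eq_of_eqOn_interior h hx]
  · exact setIntegral_congr_fun isClosed_frontier.measurableSet fun x hx => by
      simp only [h (hM.frontier_subset hx)]

theorem fluxDefect_add (hM : IsCompact M) (harea : μHE[2] (frontier M) < ⊤) {w w' : R3 → ℝ}
    (hw : HasBoundedDerivOn M w) (hw' : HasBoundedDerivOn M w') (e : R3) :
    fluxDefect M e (fun x => w x + w' x) = fluxDefect M e w + fluxDefect M e w' := by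
  have h1 : ∫ x in interior M, fderiv ℝ (fun x => w x + w' x) x e =
      (∫ x in interior M, fderiv ℝ w x e) + ∫ x in interior M, fderiv ℝ w' x e := by
    rw [← integral_add (hw.integrableOn_fderiv hM e) (hw'.integrableOn_fderiv hM e)]
    refine setIntegral_congr_fun isOpen_interior.measurableSet fun x hx => ?_
    simp only [fderiv_fun_add (hw.differentiableAt hx) (hw'.differentiableAt hx)]
    rfl
  have h2 : ∫ x in frontier M, (w x + w' x) * inner ℝ (outwardNormal M x) e ∂μHE[2] =
      (∫ x in frontier M, w x * inner ℝ (outwardNormal M x) e ∂μHE[2]) +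
        ∫ x in frontier M, w' x * inner ℝ (outwardNormal M x) e ∂μHE[2] := by
    simp only [add_mul]
    exact integral_add (hw.integrableOn_mul_normal hM harea e)
      (hw'.integrableOn_mul_normal hM harea e)
  unfold fluxDefect
  rw [h1, h2]; ring

theorem HasBoundedDerivOn.sum {ι : Type*} (s : Finset ι) {w : ι → R3 → ℝ}
    (hw : ∀ i ∈ s, HasBoundedDerivOn M (w i)) :
    HasBoundedDerivOn M fun x => ∑ i ∈ s, w i x := by
  classical
  induction s using Finset.induction_on with
  | empty => simpa using HasBoundedDerivOn.const (M := M) 0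
  | insert a s ha ih =>
    simp only [Finset.sum_insert ha]
    exact (hw a (Finset.mem_insert_self a s)).add
      (ih fun i hi => hw i (Finset.mem_insert_of_mem hi))

theorem fluxDefect_sum (hM : IsCompact M) (harea : μHE[2] (frontier M) < ⊤) {ι : Type*}
    (s : Finset ι) {w : ι → R3 → ℝ} (hw : ∀ i ∈ s, HasBoundedDerivOn M (w i)) (e : R3) :
    fluxDefect M e (fun x => ∑ i ∈ s, w i x) = ∑ i ∈ s, fluxDefect M e (w i) := by
  classical
  induction s using Finset.induction_on with
  | empty => simp [fluxDefect]
  | insert a s ha ih =>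
    simp only [Finset.sum_insert ha]
    rw [fluxDefect_add hM harea (hw a (Finset.mem_insert_self a s))
      (HasBoundedDerivOn.sum s fun i hi => hw i (Finset.mem_insert_of_mem hi)),
      ih fun i hi => hw i (Finset.mem_insert_of_mem hi)]

theorem exists_ball_abs_fluxDefect_le (hM : IsCompact M) (harea : μHE[2] (frontier M) < ⊤)
    {p : R3} (hp : p ∈ M) (hps : p ∉ frontier M \ regularBoundary M) {ε : ℝ} (hε : 0 < ε) :
    ∃ r > 0, ∀ χ : R3 → ℝ, ContDiff ℝ 1 χ → (∀ x, 0 ≤ χ x) → tsupport χ ⊆ ball p r →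
      ∀ w, HasBoundedDerivOn M w → (∀ x ∈ M, 0 ≤ w x) → ∀ e : R3, ‖e‖ ≤ 1 →
        |fluxDefect M e fun x => χ x * w x| ≤ ε * ∫ x in frontier M, χ x * w x ∂μHE[2] := by
  obtain ⟨r, hr, h⟩ := exists_ball_flux_near_boundaryFlux hM harea hp hps hε
  refine ⟨r, hr, fun χ hχ hχ0 hsupp w hw hnn e he => ?_⟩
  have hχw := (HasBoundedDerivOn.of_contDiff hM hχ).mul hM hw
  have hz : ∀ x ∉ ball p r, χ x = 0 := fun x hx =>
    image_eq_zero_of_notMem_tsupport fun h => hx (hsupp h)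
  have h1 := h _ hχw (fun x hx => by rw [hz x hx.2, zero_mul])
    (fun x hx => mul_nonneg (hχ0 x) (hnn x hx)) e he
  unfold fluxDefect
  rw [setIntegral_eq_of_subset_of_forall_sdiff_eq_zero (s := interior M ∩ ball p r)
    isOpen_interior.measurableSet inter_subset_left,
    setIntegral_eq_of_subset_of_forall_sdiff_eq_zero (s := frontier M ∩ ball p r)
    isClosed_frontier.measurableSet inter_subset_left,
    setIntegral_eq_of_subset_of_forall_sdiff_eq_zero (s := frontier M ∩ ball p r)
    isClosed_frontier.measurableSet inter_subset_left]
  · exact h1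
  · intro x hx
    rw [hz x fun h => hx.2 ⟨hx.1, h⟩, zero_mul]
  · intro x hx
    beta_reduce
    rw [hz x fun h => hx.2 ⟨hx.1, h⟩, zero_mul, zero_mul]
  · intro x hx
    have hx' : x ∉ tsupport χ := fun h => hx.2 ⟨hx.1, hsupp h⟩
    have : (fun x => χ x * w x) =ᶠ[𝓝 x] fun _ => 0 := by
      filter_upwards [(isClosed_tsupport χ).isOpen_compl.mem_nhds hx'] with y hy
      rw [image_eq_zero_of_notMem_tsupport hy, zero_mul]
    rw [this.fderiv_eq]
    simp

/-- The divergence theorem for fields vanishing near the singular part of the boundary. -/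
theorem fluxDefect_eq_zero_of_vanishing_near_singular (hM : IsCompact M)
    (harea : μHE[2] (frontier M) < ⊤) {w : R3 → ℝ} (hw : HasBoundedDerivOn M w) {V : Set R3}
    (hV : IsOpen V) (hSV : frontier M \ regularBoundary M ⊆ V) (hw0 : ∀ x ∈ M ∩ V, w x = 0)
    {e : R3} (he : ‖e‖ ≤ 1) : fluxDefect M e w = 0 := by
  obtain ⟨C, hC0, hC⟩ := hw.exists_abs_le hM
  set A := (μHE[2].restrict (frontier M)).real univ with hA
  have hA0 : 0 ≤ A := measureReal_nonneg
  -- The local estimate needs nonnegative weights, so `w` is written as `(w + C) - C`; these weights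
  -- are at most `2C` and `C`, which gives `3C` times the total area `A`.
  have key : ∀ ε > 0, |fluxDefect M e w| ≤ ε * (3 * C * A) := by
    intro ε hε
    have hK : IsCompact (M \ V) := hM.diff hV
    have hr : ∀ p : R3, ∃ r > 0, p ∈ M \ V → ∀ χ : R3 → ℝ, ContDiff ℝ 1 χ → (∀ x, 0 ≤ χ x) →
        tsupport χ ⊆ ball p r → ∀ w, HasBoundedDerivOn M w → (∀ x ∈ M, 0 ≤ w x) →
        |fluxDefect M e fun x => χ x * w x| ≤ ε * ∫ x in frontier M, χ x * w x ∂μHE[2] := by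
      intro p
      by_cases hp : p ∈ M \ V
      · obtain ⟨r, hr, h⟩ := exists_ball_abs_fluxDefect_le hM harea hp.1
          (fun hps => hp.2 (hSV hps)) hε
        exact ⟨r, hr, fun _ χ h1 h2 h3 w h4 h5 => h χ h1 h2 h3 w h4 h5 e he⟩
      · exact ⟨1, one_pos, fun h => absurd h hp⟩
    choose r hr0 hr using hr
    obtain ⟨t, htK, htc⟩ := hK.elim_nhds_subcover (fun p => ball p (r p))
      fun p _ => ball_mem_nhds p (hr0 p)
    obtain ⟨χ, hχ⟩ := SmoothPartitionOfUnity.exists_isSubordinate (ι := {p // p ∈ t})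
      (modelWithCornersSelf ℝ R3) hK.isClosed (fun p => ball p.1 (r p.1)) (fun _ => isOpen_ball)
      (htc.trans (iUnion₂_subset fun p hp => subset_iUnion_of_subset ⟨p, hp⟩ subset_rfl))
    have hχs : ∀ i, ContDiff ℝ 1 (χ i) := fun i =>
      ((χ i).contMDiff.contDiff).of_le (by exact_mod_cast le_top)
    have hχ0 : ∀ i x, 0 ≤ χ i x := fun i x => χ.nonneg i x
    have hχb : ∀ i, HasBoundedDerivOn M (χ i) := fun i => .of_contDiff hM (hχs i)
    have hsum : ∀ x ∈ M \ V, ∑ i, χ i x = 1 := fun x hx => by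
      rw [← χ.sum_eq_one hx, finsum_eq_sum_of_fintype]
    have hsum_le : ∀ x, ∑ i, χ i x ≤ 1 := fun x => by
      rw [← finsum_eq_sum_of_fintype]; exact χ.sum_le_one x
    -- The functions sum to `1` only off `V`, but `w` vanishes on `M ∩ V`.
    have hdecomp : EqOn w (fun x => ∑ i, χ i x * w x) M := fun x hx => by
      simp only
      rw [← Finset.sum_mul]
      by_cases hxV : x ∈ V
      · rw [hw0 x ⟨hx, hxV⟩, mul_zero]
      · rw [hsum x ⟨hx, hxV⟩, one_mul]
    have hwC := hw.add (HasBoundedDerivOn.const (M := M) C)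
    have hpiece : ∀ i, |fluxDefect M e fun x => χ i x * w x| ≤
        ε * (3 * C * ∫ x in frontier M, χ i x ∂μHE[2]) := by
      intro i
      have h1 := hr i.1 (htK i.1 i.2) (χ i) (hχs i) (hχ0 i) (hχ i) _ hwC
        (fun x hx => by linarith [(abs_le.1 (hC x hx)).1])
      have h2 := hr i.1 (htK i.1 i.2) (χ i) (hχs i) (hχ0 i) (hχ i) _
        (HasBoundedDerivOn.const (M := M) C) (fun x hx => hC0)
      have h3 : fluxDefect M e (fun x => χ i x * (w x + C)) =
          fluxDefect M e (fun x => χ i x * w x) + fluxDefect M e fun x => χ i x * C := by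
        rw [← fluxDefect_add hM harea ((hχb i).mul hM hw) ((hχb i).mul hM (.const C))]
        simp only [mul_add]
      have h4 : (∫ x in frontier M, χ i x * (w x + C) ∂μHE[2]) +
          ∫ x in frontier M, χ i x * C ∂μHE[2] ≤ 3 * C * ∫ x in frontier M, χ i x ∂μHE[2] := by
        rw [← integral_add (((hχb i).mul hM hwC).integrableOn_frontier hM harea)
          (((hχb i).mul hM (.const C)).integrableOn_frontier hM harea), ← integral_const_mul]
        refine setIntegral_mono_on ((((hχb i).mul hM hwC).integrableOn_frontier hM harea).add
          (((hχb i).mul hM (.const C)).integrableOn_frontier hM harea))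
          (((hχb i).integrableOn_frontier hM harea).const_mul _) isClosed_frontier.measurableSet
          fun x hx => ?_
        have := (abs_le.1 (hC x (hM.isClosed.frontier_subset hx))).2
        nlinarith [hχ0 i x]
      have h5 : fluxDefect M e (fun x => χ i x * w x) =
          fluxDefect M e (fun x => χ i x * (w x + C)) - fluxDefect M e fun x => χ i x * C := by
        rw [h3]; ring
      rw [h5]
      refine (abs_sub _ _).trans ((add_le_add h1 h2).trans ?_)
      rw [← mul_add]
      gcongr
    rw [fluxDefect_congr hM.isClosed hdecomp,
      fluxDefect_sum hM harea _ fun i _ => (hχb i).mul hM hw]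
    refine (Finset.abs_sum_le_sum_abs _ _).trans ((Finset.sum_le_sum fun i _ => hpiece i).trans ?_)
    rw [← Finset.mul_sum, ← Finset.mul_sum,
      ← integral_finsetSum _ fun i _ => (hχb i).integrableOn_frontier hM harea]
    gcongr
    have hfin : IsFiniteMeasure (μHE[2].restrict (frontier M)) := ⟨by simpa using harea⟩
    calc ∫ x in frontier M, ∑ i, χ i x ∂μHE[2] ≤ ∫ x in frontier M, (1 : ℝ) ∂μHE[2] :=
          integral_mono (integrable_finsetSum _ fun i _ => (hχb i).integrableOn_frontier hM harea)
            (integrable_const _) hsum_le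
      _ = A := by rw [integral_const, smul_eq_mul, mul_one]
  have h0 : |fluxDefect M e w| ≤ 0 := by
    refine le_of_forall_pos_le_add fun δ hδ => ?_
    have hB : 0 < 3 * C * A + 1 := by positivity
    have := key (δ / (3 * C * A + 1)) (by positivity)
    rw [zero_add]
    refine this.trans ?_
    rw [div_mul_eq_mul_div, div_le_iff₀ hB]
    nlinarith
  exact abs_nonpos_iff.1 h0

end GlobalFlux

/-! ### Cutting off a compact set of zero area. -/

section Cutoff

open Set Metric Filter Topology

/-- Zero two-dimensional measure gives countable covers with small sum of squared diameters. Each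
covering set that meets `S` has its trace on `S` put in a slightly larger ball centred in `S`, and
compactness leaves finitely many. -/
theorem exists_finite_ball_cover {X : Type*} [Nonempty X] [MetricSpace X] [MeasurableSpace X]
    [BorelSpace X] {S : Set X} (hS : IsCompact S) (h0 : μHE[2] S = 0) {ε : ℝ} (hε : 0 < ε) :
    ∃ (F : Finset ℕ) (c : ℕ → X) (ρ : ℕ → ℝ), (∀ i ∈ F, c i ∈ S ∧ 0 < ρ i) ∧
      (S ⊆ ⋃ i ∈ F, ball (c i) (ρ i)) ∧ ∑ i ∈ F, ρ i ^ 2 < ε := by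
  classical
  have hH : μH[(2 : ℕ)] S = 0 := by
    rw [Measure.euclideanHausdorffMeasure_def, Measure.smul_apply, ENNReal.smul_def, smul_eq_mul,
      mul_eq_zero, ENNReal.coe_eq_zero] at h0
    exact h0.resolve_left (Measure.addHaarScalarFactor_volume_hausdorffMeasure_ne_zero 2)
  set ε' := ENNReal.ofReal (ε / 2) with hε'
  have hε'0 : 0 < ε' := ENNReal.ofReal_pos.2 (half_pos hε)
  rw [Measure.hausdorffMeasure_apply] at hH
  -- Covers at scale `1` suffice: the scale only serves to make all diameters finite.
  have h1 := (le_iSup₂_of_le (f := fun (r : ENNReal) (_ : 0 < r) =>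
    ⨅ (t : ℕ → Set X) (_ : S ⊆ ⋃ n, t n) (_ : ∀ n, ediam (t n) ≤ r),
          ∑' n, ⨆ _ : (t n).Nonempty, ediam (t n) ^ ((2 : ℕ) : ℝ)) 1 one_pos le_rfl).trans
            (hH.le.trans bot_le) |>.trans_lt hε'0
  simp only [iInf_lt_iff] at h1
  obtain ⟨t, hSt, ht1, hsum⟩ := h1
  -- The summable `δ n` make the radii positive even for covering sets of diameter zero, and make
  -- the balls open neighbourhoods.
  obtain ⟨δ, hδ0, hδ⟩ := ENNReal.exists_pos_sum_of_countable hε'0.ne' ℕ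
  have hch : ∀ n, ∃ (c : X), (t n ∩ S).Nonempty → c ∈ t n ∩ S := fun n => by
    by_cases h : (t n ∩ S).Nonempty
    · exact ⟨h.some, fun _ => h.some_mem⟩
    · exact ⟨Classical.arbitrary X, fun h' => absurd h' h⟩
  choose c hc using hch
  have hfin : ∀ n, ediam (t n) ≠ ⊤ := fun n => ((ht1 n).trans_lt ENNReal.one_lt_top).ne
  set ρ : ℕ → ℝ := fun n => √(diam (t n) ^ 2 + δ n) with hρ
  have hpos : ∀ n, 0 < diam (t n) ^ 2 + δ n := fun n => by
    have : (0 : ℝ) < δ n := hδ0 n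
    positivity
  have hsub : ∀ n, ∀ x ∈ t n ∩ S, x ∈ ball (c n) (ρ n) := by
    intro n x hx
    rw [mem_ball]
    refine (dist_le_diam_of_mem' (hfin n) hx.1 (hc n ⟨x, hx⟩).1).trans_lt ?_
    refine Real.lt_sqrt_of_sq_lt ?_
    have : (0 : ℝ) < δ n := hδ0 n
    linarith
  obtain ⟨F, hF⟩ := hS.elim_finite_subcover (fun n => ⋃ _ : (t n ∩ S).Nonempty, ball (c n) (ρ n))
    (fun n => isOpen_iUnion fun _ => isOpen_ball) (fun x hx => by
      obtain ⟨n, hn⟩ := mem_iUnion.1 (hSt hx)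
      exact mem_iUnion.2 ⟨n, mem_iUnion.2 ⟨⟨x, hn, hx⟩, hsub n x ⟨hn, hx⟩⟩⟩)
  refine ⟨F.filter fun n => (t n ∩ S).Nonempty, c, ρ, fun i hi => ?_, fun x hx => ?_, ?_⟩
  · exact ⟨(hc i (Finset.mem_filter.1 hi).2).2, Real.sqrt_pos.2 (hpos i)⟩
  · obtain ⟨n, hn, hx'⟩ := mem_iUnion₂.1 (hF hx)
    obtain ⟨hne, hx''⟩ := mem_iUnion.1 hx'
    exact mem_iUnion₂.2 ⟨n, Finset.mem_filter.2 ⟨hn, hne⟩, hx''⟩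
  · set G := F.filter fun n => (t n ∩ S).Nonempty
    have hterm : ∀ n ∈ G, ENNReal.ofReal (ρ n ^ 2) =
        (⨆ _ : (t n).Nonempty, ediam (t n) ^ ((2 : ℕ) : ℝ)) + δ n := by
      intro n hn
      have hne : (t n).Nonempty := (Finset.mem_filter.1 hn).2.mono inter_subset_left
      rw [ciSup_pos hne, Real.sq_sqrt (hpos n).le, ENNReal.ofReal_add (sq_nonneg _) (δ n).coe_nonneg,
        ENNReal.ofReal_pow diam_nonneg, ENNReal.rpow_natCast, diam, ENNReal.ofReal_toReal (hfin n),
        ENNReal.ofReal_coe_nnreal]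
    have hlt : ENNReal.ofReal (∑ i ∈ G, ρ i ^ 2) < ENNReal.ofReal ε := by
      rw [ENNReal.ofReal_sum_of_nonneg fun i _ => sq_nonneg _, Finset.sum_congr rfl hterm,
        Finset.sum_add_distrib, ← add_halves ε, ENNReal.ofReal_add (half_pos hε).le (half_pos hε).le]
      exact ENNReal.add_lt_add ((ENNReal.sum_le_tsum G).trans_lt hsum)
        ((ENNReal.sum_le_tsum G).trans_lt hδ)
    exact (ENNReal.ofReal_lt_ofReal_iff hε).1 hlt

/-- A `C¹` bump equal to `1` on the ball of radius `ρ` and supported in the ball of radius `2ρ`. -/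
theorem exists_bump_gradient_bound : ∃ K : ℝ, 0 ≤ K ∧ ∀ (c : R3) (ρ : ℝ), 0 < ρ →
    ∃ ψ : R3 → ℝ, ContDiff ℝ 1 ψ ∧ (∀ x, 0 ≤ ψ x ∧ ψ x ≤ 1) ∧ (∀ x ∈ ball c ρ, ψ x = 1) ∧
      (∀ x ∉ ball c (2 * ρ), ψ x = 0) ∧ Integrable (fun x => ‖fderiv ℝ ψ x‖) ∧
      ∫ x, ‖fderiv ℝ ψ x‖ ≤ K * ρ ^ 2 := by
  let β : ContDiffBump (0 : R3) := ⟨1, 2, one_pos, one_lt_two⟩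
  have hβ : ContDiff ℝ 1 β := β.contDiff
  have hβc : Continuous (fderiv ℝ β) := hβ.continuous_fderiv (by norm_num)
  have hβs : HasCompactSupport (fderiv ℝ β) := β.hasCompactSupport.fderiv (𝕜 := ℝ)
  -- Rescaling the unit bump to radius `ρ` multiplies the gradient by `ρ⁻¹` and the volume by `ρ³`,
  -- hence the factor `ρ²`.
  refine ⟨∫ x, ‖fderiv ℝ β x‖, integral_nonneg fun _ => norm_nonneg _, fun c ρ hρ => ?_⟩
  have hφ : ContDiff ℝ 1 fun x : R3 => ρ⁻¹ • (x - c) := by fun_prop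
  have hfd : ∀ x, fderiv ℝ (fun x => β (ρ⁻¹ • (x - c))) x =
      ρ⁻¹ • fderiv ℝ β (ρ⁻¹ • (x - c)) := by
    intro x
    have h1 : HasFDerivAt (fun x : R3 => ρ⁻¹ • (x - c)) (ρ⁻¹ • ContinuousLinearMap.id ℝ R3) x :=
      ((hasFDerivAt_id x).sub_const c).const_smul ρ⁻¹
    have h2 := ((hβ.differentiable (by norm_num) (ρ⁻¹ • (x - c))).hasFDerivAt).comp x h1
    rw [show (fun x => β (ρ⁻¹ • (x - c))) = β ∘ fun x => ρ⁻¹ • (x - c) from rfl, h2.fderiv]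
    ext v; simp
  have hnorm : ∀ x, ‖fderiv ℝ (fun x => β (ρ⁻¹ • (x - c))) x‖ =
      ρ⁻¹ * ‖fderiv ℝ β (ρ⁻¹ • (x - c))‖ := fun x => by
    rw [hfd, norm_smul, Real.norm_of_nonneg (inv_pos.2 hρ).le]
  have hint : Integrable fun x : R3 => ‖fderiv ℝ β x‖ :=
    (hβc.integrable_of_hasCompactSupport hβs).norm
  have hdist : ∀ x, dist (ρ⁻¹ • (x - c)) 0 = ρ⁻¹ * dist x c := fun x => by
    rw [dist_zero_right, norm_smul, Real.norm_of_nonneg (inv_pos.2 hρ).le, dist_eq_norm]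
  refine ⟨fun x => β (ρ⁻¹ • (x - c)), hβ.comp hφ, fun x => ⟨β.nonneg, β.le_one⟩, fun x hx => ?_,
    fun x hx => ?_, ?_, ?_⟩
  · refine β.one_of_mem_closedBall ?_
    rw [mem_closedBall, hdist, inv_mul_le_iff₀ hρ]
    simpa [β] using (mem_ball.1 hx).le
  · refine β.zero_of_le_dist ?_
    rw [hdist, le_inv_mul_iff₀ hρ]
    simpa [β, mul_comm] using hx
  · simp_rw [hnorm]
    exact ((hint.comp_smul (inv_ne_zero hρ.ne')).comp_sub_right c).const_mul _
  · simp_rw [hnorm]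
    rw [integral_const_mul, integral_sub_right_eq_self (fun x => ‖fderiv ℝ β (ρ⁻¹ • x)‖) c,
      Measure.integral_comp_smul volume (fun x => ‖fderiv ℝ β x‖)]
    refine le_of_eq ?_
    rw [finrank_euclideanSpace, Fintype.card_fin, abs_of_pos (by positivity), smul_eq_mul]
    field_simp

/-- Cutoff functions vanishing near a compact set of zero area, with small gradient. -/
theorem exists_cutoff {S : Set R3} (hS : IsCompact S) (h0 : μHE[2] S = 0) :
    ∃ K : ℝ, 0 ≤ K ∧ ∀ ε : ℝ, 0 < ε → ∃ θ : R3 → ℝ, ContDiff ℝ 1 θ ∧ (∀ x, 0 ≤ θ x ∧ θ x ≤ 1) ∧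
      (∃ V, IsOpen V ∧ S ⊆ V ∧ ∀ x ∈ V, θ x = 0) ∧
      (∀ x, (∀ y ∈ S, 2 * √ε ≤ dist x y) → θ x = 1) ∧
      Integrable (fun x => ‖fderiv ℝ θ x‖) ∧ ∫ x, ‖fderiv ℝ θ x‖ ≤ K * ε := by
  obtain ⟨K, hK0, hK⟩ := exists_bump_gradient_bound
  refine ⟨K, hK0, fun ε hε => ?_⟩
  obtain ⟨F, c, ρ, hcρ, hcov, hsum⟩ := exists_finite_ball_cover hS h0 hε
  have hch : ∀ i, ∃ ψ : R3 → ℝ, i ∈ F → ContDiff ℝ 1 ψ ∧ (∀ x, 0 ≤ ψ x ∧ ψ x ≤ 1) ∧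
      (∀ x ∈ ball (c i) (ρ i), ψ x = 1) ∧ (∀ x ∉ ball (c i) (2 * ρ i), ψ x = 0) ∧
      Integrable (fun x => ‖fderiv ℝ ψ x‖) ∧ ∫ x, ‖fderiv ℝ ψ x‖ ≤ K * ρ i ^ 2 := fun i => by
    by_cases hi : i ∈ F
    · obtain ⟨ψ, h⟩ := hK (c i) (ρ i) (hcρ i hi).2
      exact ⟨ψ, fun _ => h⟩
    · exact ⟨0, fun h => absurd h hi⟩
  choose ψ hψ using hch
  -- The cutoff is the product of the `1 - ψ i`. All factors lie in `[0, 1]`, so the product rule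
  -- bounds its gradient by the sum of the gradients, however much the balls overlap.
  have hprod : ∀ G : Finset ℕ, G ⊆ F → ContDiff ℝ 1 (fun x => ∏ i ∈ G, (1 - ψ i x)) ∧
      (∀ x, 0 ≤ ∏ i ∈ G, (1 - ψ i x) ∧ ∏ i ∈ G, (1 - ψ i x) ≤ 1) ∧
      ∀ x, ‖fderiv ℝ (fun x => ∏ i ∈ G, (1 - ψ i x)) x‖ ≤ ∑ i ∈ G, ‖fderiv ℝ (ψ i) x‖ := by
    intro G
    induction G using Finset.induction_on with
    | empty => intro _; simp [contDiff_const]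
    | insert a G ha ih =>
      intro hG
      obtain ⟨h1, h2, h3⟩ := ih ((Finset.subset_insert a G).trans hG)
      obtain ⟨g1, g2, -, -, -, -⟩ := hψ a (hG (Finset.mem_insert_self a G))
      have g1' : ContDiff ℝ 1 fun x => 1 - ψ a x := contDiff_const.sub g1
      simp only [Finset.prod_insert ha, Finset.sum_insert ha]
      refine ⟨g1'.mul h1, fun x => ⟨mul_nonneg (by linarith [(g2 x).2]) (h2 x).1,
        mul_le_one₀ (by linarith [(g2 x).1]) (h2 x).1 (h2 x).2⟩, fun x => ?_⟩
      rw [fderiv_fun_mul (g1'.differentiable (by norm_num) x) (h1.differentiable (by norm_num) x),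
        fderiv_const_sub, add_comm]
      refine (norm_add_le _ _).trans (add_le_add ?_ ?_)
      · rw [norm_smul, norm_neg, Real.norm_of_nonneg (h2 x).1]
        exact mul_le_of_le_one_left (norm_nonneg _) (h2 x).2
      · rw [norm_smul, Real.norm_of_nonneg (by linarith [(g2 x).2])]
        exact (mul_le_of_le_one_left (norm_nonneg _) (by linarith [(g2 x).1])).trans (h3 x)
  obtain ⟨hθ, hθ01, hθ'⟩ := hprod F subset_rfl
  have hint : Integrable fun x => ∑ i ∈ F, ‖fderiv ℝ (ψ i) x‖ :=
    integrable_finsetSum _ fun i hi => (hψ i hi).2.2.2.2.1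
  refine ⟨_, hθ, hθ01, ⟨⋃ i ∈ F, ball (c i) (ρ i), isOpen_biUnion fun _ _ => isOpen_ball, hcov,
    fun x hx => ?_⟩, fun x hx => ?_, ?_, ?_⟩
  · obtain ⟨i, hi, hxi⟩ := mem_iUnion₂.1 hx
    exact Finset.prod_eq_zero hi (by rw [(hψ i hi).2.2.1 x hxi, sub_self])
  · refine Finset.prod_eq_one fun i hi => ?_
    rw [(hψ i hi).2.2.2.1 x, sub_zero]
    -- Each single `ρ i ^ 2` is below the whole sum, so the supports stay within `2 * √ε` of `S`.
    have h1 : ρ i ≤ √ε := Real.le_sqrt_of_sq_le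
      ((Finset.single_le_sum (f := fun i => ρ i ^ 2) (fun i _ => sq_nonneg _) hi).trans hsum.le)
    have := hx (c i) (hcρ i hi).1
    rw [mem_ball, not_lt]
    linarith
  · refine hint.mono' ((hθ.continuous_fderiv (by norm_num)).norm.aestronglyMeasurable) ?_
    exact .of_forall fun x => by rw [norm_norm]; exact hθ' x
  · calc ∫ x, ‖fderiv ℝ (fun x => ∏ i ∈ F, (1 - ψ i x)) x‖
        ≤ ∫ x, ∑ i ∈ F, ‖fderiv ℝ (ψ i) x‖ :=
          integral_mono_of_nonneg (.of_forall fun _ => norm_nonneg _) hint (.of_forall hθ')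
      _ = ∑ i ∈ F, ∫ x, ‖fderiv ℝ (ψ i) x‖ :=
          integral_finsetSum _ fun i hi => (hψ i hi).2.2.2.2.1
      _ ≤ ∑ i ∈ F, K * ρ i ^ 2 := Finset.sum_le_sum fun i hi => (hψ i hi).2.2.2.2.2
      _ = K * ∑ i ∈ F, ρ i ^ 2 := (Finset.mul_sum _ _ _).symm
      _ ≤ K * ε := by gcongr

end Cutoff

/-! ### The divergence theorem on the whole region. -/

section Divergence

open Set Metric Filter Topology

variable {M : Set R3}

/-- The divergence theorem for a field `w • e` with bounded derivative. -/
theorem fluxDefect_eq_zero (hM : IsPiecewiseSmoothRegion M) {w : R3 → ℝ}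
    (hw : HasBoundedDerivOn M w) {e : R3} (he : ‖e‖ ≤ 1) : fluxDefect M e w = 0 := by
  have hMc := hM.isCompact
  set S := frontier M \ regularBoundary M with hSdef
  have hSc : IsCompact S := hMc.of_isClosed_subset isClosed_singularBoundary
    (sdiff_subset.trans hMc.isClosed.frontier_subset)
  obtain ⟨K, -, hK⟩ := exists_cutoff hSc hM.area_singular
  set ε : ℕ → ℝ := fun k => 1 / ((k : ℝ) + 1) with hε
  have hε0 : ∀ k, 0 < ε k := fun k => by positivity
  have hεl : Tendsto ε atTop (𝓝 0) := tendsto_one_div_add_atTop_nhds_zero_nat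
  choose θ hθ1 hθ01 hθV hθone hθi hθK using fun k => hK (ε k) (hε0 k)
  have hθb : ∀ k, HasBoundedDerivOn M (θ k) := fun k => .of_contDiff hMc (hθ1 k)
  have hlim : ∀ x ∉ S, Tendsto (fun k => θ k x) atTop (𝓝 1) := by
    intro x hx
    refine tendsto_const_nhds.congr' ?_
    obtain ⟨δ, hδ, hball⟩ := Metric.isOpen_iff.1 hSc.isClosed.isOpen_compl x hx
    have h1 : Tendsto (fun k => 2 * √(ε k)) atTop (𝓝 0) := by
      simpa using (hεl.sqrt).const_mul 2
    filter_upwards [h1.eventually_lt_const hδ] with k hk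
    refine (hθone k x fun y hy => ?_).symm
    by_contra! h
    exact hball (mem_ball'.2 (h.trans hk)) hy
  obtain ⟨C, hC0, hC⟩ := hw.exists_abs_le hMc
  -- The vanishing defect of `θ k * w`, expanded by the product rule; each of the three terms has
  -- its own limit.
  have hzero : ∀ k, (∫ x in interior M, θ k x * fderiv ℝ w x e) +
      (∫ x in interior M, w x * fderiv ℝ (θ k) x e) -
      ∫ x in frontier M, θ k x * (w x * inner ℝ (outwardNormal M x) e) ∂μHE[2] = 0 := by
    intro k
    obtain ⟨V, hV, hSV, hV0⟩ := hθV k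
    rw [← fluxDefect_eq_zero_of_vanishing_near_singular hMc hM.area_lt_top ((hθb k).mul hMc hw) hV
      hSV (fun x hx => by rw [hV0 x hx.2, zero_mul]) he, fluxDefect]
    have hi1 : IntegrableOn (fun x => θ k x * fderiv ℝ w x e) (interior M) :=
      (hw.integrableOn_fderiv hMc e).bdd_mul (c := 1) (hθ1 k).continuous.aestronglyMeasurable
        (.of_forall fun x => by
          rw [Real.norm_of_nonneg (hθ01 k x).1]; exact (hθ01 k x).2)
    have hi2 : IntegrableOn (fun x => w x * fderiv ℝ (θ k) x e) (interior M) := by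
      refine ((hθb k).integrableOn_fderiv hMc e).bdd_mul (c := C) ?_ ?_
      · exact (hw.continuousOn.mono interior_subset).aestronglyMeasurable
          isOpen_interior.measurableSet
      · filter_upwards [ae_restrict_mem isOpen_interior.measurableSet] with x hx
        exact hC x (interior_subset hx)
    rw [← integral_add hi1 hi2]
    congr 1
    · exact setIntegral_congr_fun isOpen_interior.measurableSet fun x hx =>
        ((hθb k).fderiv_mul_apply hw hx e).symm
    · simp only [mul_assoc]
  have hl1 : Tendsto (fun k => ∫ x in interior M, θ k x * fderiv ℝ w x e) atTop
      (𝓝 (∫ x in interior M, fderiv ℝ w x e)) := by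
    refine tendsto_integral_of_dominated_convergence (fun x => ‖fderiv ℝ w x e‖)
      (fun k => ?_) (hw.integrableOn_fderiv hMc e).norm (fun k => .of_forall fun x => ?_) ?_
    · exact (hθ1 k).continuous.aestronglyMeasurable.mul (hw.integrableOn_fderiv hMc e).1
    · rw [norm_mul, Real.norm_of_nonneg (hθ01 k x).1]
      exact mul_le_of_le_one_left (norm_nonneg _) (hθ01 k x).2
    · filter_upwards [ae_restrict_mem isOpen_interior.measurableSet] with x hx
      simpa using (hlim x fun h => h.1.2 hx).mul_const (fderiv ℝ w x e)
  have hl3 : Tendsto (fun k => ∫ x in frontier M,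
      θ k x * (w x * inner ℝ (outwardNormal M x) e) ∂μHE[2]) atTop
      (𝓝 (∫ x in frontier M, w x * inner ℝ (outwardNormal M x) e ∂μHE[2])) := by
    have hi := hw.integrableOn_mul_normal hMc hM.area_lt_top e
    refine tendsto_integral_of_dominated_convergence
      (fun x => ‖w x * inner ℝ (outwardNormal M x) e‖)
      (fun k => ?_) hi.norm (fun k => .of_forall fun x => ?_) ?_
    · exact (hθ1 k).continuous.aestronglyMeasurable.mul hi.1
    · rw [norm_mul, Real.norm_of_nonneg (hθ01 k x).1]
      exact mul_le_of_le_one_left (norm_nonneg _) (hθ01 k x).2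
    · have hS0 : ∀ᵐ x ∂μHE[2].restrict (frontier M), x ∉ S :=
        ae_restrict_of_ae (measure_eq_zero_iff_ae_notMem.1 hM.area_singular)
      filter_upwards [hS0] with x hx
      simpa using (hlim x hx).mul_const (w x * inner ℝ (outwardNormal M x) e)
  -- The term with the cutoff's gradient is at most `C * (K * ε k)`; this is where zero area of the
  -- singular set matters for the volume integral.
  have hl2 : Tendsto (fun k => ∫ x in interior M, w x * fderiv ℝ (θ k) x e) atTop (𝓝 0) := by
    refine squeeze_zero_norm (a := fun k => C * (K * ε k)) (fun k => ?_)
      (by simpa using (hεl.const_mul K).const_mul C)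
    refine (norm_integral_le_of_norm_le (g := fun x => C * ‖fderiv ℝ (θ k) x‖)
      ((hθi k).integrableOn.const_mul C) ?_).trans ?_
    · filter_upwards [ae_restrict_mem isOpen_interior.measurableSet] with x hx
      rw [norm_mul]
      refine mul_le_mul (hC x (interior_subset hx)) ?_ (norm_nonneg _) hC0
      exact (ContinuousLinearMap.le_opNorm _ _).trans (mul_le_of_le_one_right (norm_nonneg _) he)
    · rw [integral_const_mul]
      gcongr
      exact (setIntegral_le_integral (hθi k) (.of_forall fun _ => norm_nonneg _)).trans (hθK k)
  have := (hl1.add hl2).sub hl3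
  simp only [hzero, add_zero] at this
  exact (tendsto_nhds_unique this tendsto_const_nhds)

/-- Derivatives within `M` need not be unique at the frontier. Near each point of `M`, however,
there is some derivative field continuous at that point within `M`, hence locally bounded; it agrees
with the true derivative in the interior, and compactness makes the bound global. -/
theorem HasBoundedDerivOn.of_contDiffOn (hM : IsCompact M) {w : R3 → ℝ}
    (hw : ContDiffOn ℝ 1 w M) : HasBoundedDerivOn M w := by
  refine ⟨hw.continuousOn, (hw.differentiableOn (by norm_num)).mono interior_subset, ?_⟩
  have key : ∃ C, ∀ x ∈ M, x ∈ interior M → ‖fderiv ℝ w x‖ ≤ C := by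
    refine hM.induction_on (p := fun s => ∃ C, ∀ x ∈ s, x ∈ interior M → ‖fderiv ℝ w x‖ ≤ C)
      ⟨0, fun x hx => absurd hx (notMem_empty x)⟩
      (fun s t hst ⟨C, h⟩ => ⟨C, fun x hx => h x (hst hx)⟩)
      (fun s t ⟨C, h⟩ ⟨D, h'⟩ => ⟨max C D, fun x hx hxi => hx.elim
        (fun hx => (h x hx hxi).trans (le_max_left _ _))
        fun hx => (h' x hx hxi).trans (le_max_right _ _)⟩) fun x hx => ?_
    have h1 : ContDiffWithinAt ℝ (0 + 1) w M x := by simpa using hw x hx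
    obtain ⟨u, hu, -, -, f', hf', hf'c⟩ :=
      (contDiffWithinAt_succ_iff_hasFDerivWithinAt' (by simp)).1 h1
    rw [insert_eq_of_mem hx] at hu
    have hev := hf'c.continuousWithinAt.norm.eventually_lt_const (lt_add_one ‖f' x‖)
    refine ⟨u ∩ {y | ‖f' y‖ < ‖f' x‖ + 1}, inter_mem hu hev, ‖f' x‖ + 1,
      fun y hy hyi => ?_⟩
    rw [((hf' y hy.1).hasFDerivAt (mem_interior_iff_mem_nhds.1 hyi)).fderiv]
    exact (le_of_lt hy.2)
  obtain ⟨C, hC⟩ := key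
  exact ⟨C, fun x hx => hC x (interior_subset hx) hx⟩

/-- Finite two-dimensional measure forces zero three-dimensional measure. -/
theorem volume_frontier_eq_zero (harea : μHE[2] (frontier M) < ⊤) :
    volume (frontier M) = 0 := by
  have h := (Measure.euclideanHausdorffMeasure_zero_or_top (show 2 < 3 by norm_num)
    (frontier M)).resolve_right harea.ne
  rwa [EuclideanSpace.euclideanHausdorffMeasure_eq_volume] at h

theorem interior_ae_eq (hM : IsPiecewiseSmoothRegion M) : interior M =ᵐ[volume] M :=
  interior_ae_eq_of_null_frontier (volume_frontier_eq_zero hM.area_lt_top)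

variable {v : R3 → R3}

theorem inner_outwardNormal_eq_sum (x : R3) :
    inner ℝ (v x) (outwardNormal M x) =
      ∑ i, v x i * inner ℝ (outwardNormal M x) (basisVec i) := by
  simp [PiLp.inner_apply, basisVec, mul_comm]

variable (hM : IsPiecewiseSmoothRegion M) (hv : ContDiffOn ℝ 1 v M)

include hM hv

theorem hasBoundedDerivOn_component (i : Fin 3) : HasBoundedDerivOn M fun x => v x i :=
  .of_contDiffOn hM.isCompact (contDiffOn_euclidean.1 hv i)

omit hM in
theorem divergence_eq_of_mem_interior {x : R3} (hx : x ∈ interior M) :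
    divergence M v x = ∑ i, fderiv ℝ (fun x => v x i) x (basisVec i) := by
  unfold divergence
  have hd : DifferentiableAt ℝ v x :=
    (hv.differentiableOn (by norm_num)).differentiableAt (mem_interior_iff_mem_nhds.1 hx)
  rw [fderivWithin_of_mem_nhds (mem_interior_iff_mem_nhds.1 hx)]
  refine Finset.sum_congr rfl fun i _ => ?_
  have h1 : HasFDerivAt (fun x => v x i)
      ((EuclideanSpace.proj i : R3 →L[ℝ] ℝ).comp (fderiv ℝ v x)) x :=
    (EuclideanSpace.proj i : R3 →L[ℝ] ℝ).hasFDerivAt.comp x hd.hasFDerivAt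
  rw [h1.fderiv]
  rfl

theorem integrableOn_divergence : IntegrableOn (divergence M v) M := by
  rw [← integrableOn_congr_set_ae (interior_ae_eq hM)]
  have h := integrable_finsetSum Finset.univ fun i _ =>
    (hasBoundedDerivOn_component hM hv i).integrableOn_fderiv hM.isCompact (basisVec i)
  refine (integrableOn_congr_fun (fun x hx => ?_) isOpen_interior.measurableSet).2 h
  exact divergence_eq_of_mem_interior hv hx

theorem integrableOn_inner_outwardNormal :
    IntegrableOn (fun x => inner ℝ (v x) (outwardNormal M x)) (frontier M) μHE[2] := by
  simp only [inner_outwardNormal_eq_sum]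
  exact integrable_finsetSum Finset.univ fun i _ =>
    (hasBoundedDerivOn_component hM hv i).integrableOn_mul_normal hM.isCompact hM.area_lt_top
      (basisVec i)

/-- The divergence theorem on a region with piecewise smooth boundary. -/
theorem integral_divergence_eq : ∫ x in M, divergence M v x =
    ∫ x in frontier M, inner ℝ (v x) (outwardNormal M x) ∂μHE[2] := by
  have hb := hasBoundedDerivOn_component hM hv
  rw [← setIntegral_congr_set (interior_ae_eq hM),
    setIntegral_congr_fun isOpen_interior.measurableSet
      fun x hx => divergence_eq_of_mem_interior hv hx,
    integral_finsetSum _ fun i _ => (hb i).integrableOn_fderiv hM.isCompact (basisVec i)]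
  simp only [inner_outwardNormal_eq_sum]
  rw [integral_finsetSum _ fun i _ => (hb i).integrableOn_mul_normal hM.isCompact hM.area_lt_top
      (basisVec i)]
  refine Finset.sum_congr rfl fun i _ => sub_eq_zero.1 ?_
  exact fluxDefect_eq_zero hM (hb i) (by simp [basisVec])

end Divergence

/-! ### Duality in the geometric algebra of `ℝ³`. -/

section GeometricAlgebra

theorem vec_mul_self (u : R3) : vec u * vec u = algebraMap ℝ G3 (inner ℝ u u) :=
  CliffordAlgebra.ι_sq_scalar Q3 u

theorem vec_mul_vec_add_swap (u v : R3) :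
    vec u * vec v + vec v * vec u = algebraMap ℝ G3 (2 * inner ℝ u v) := by
  refine (CliffordAlgebra.ι_mul_ι_add_swap u v).trans (congrArg _ ?_)
  change inner ℝ (u + v) (u + v) - inner ℝ u u - inner ℝ v v = _
  rw [inner_add_left, inner_add_right, inner_add_right, real_inner_comm u v]
  ring

theorem inner_basisVec (i j : Fin 3) :
    inner ℝ (basisVec i) (basisVec j) = if i = j then (1 : ℝ) else 0 := by
  simp [basisVec, EuclideanSpace.inner_single_left]

theorem basisVec_mul_self (i : Fin 3) : vec (basisVec i) * vec (basisVec i) = 1 := by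
  rw [vec_mul_self, inner_basisVec, if_pos rfl, map_one]

theorem basisVec_mul_swap {i j : Fin 3} (h : i ≠ j) :
    vec (basisVec i) * vec (basisVec j) = -(vec (basisVec j) * vec (basisVec i)) := by
  rw [eq_neg_iff_add_eq_zero, vec_mul_vec_add_swap, inner_basisVec, if_neg h, mul_zero, map_zero]

theorem eq_sum_basisVec (u : R3) : u = ∑ i, u i • basisVec i := by
  ext j
  simp [basisVec, Fin.sum_univ_three]
  fin_cases j <;> simp

section Words

variable {R : Type*} [Ring R] {a b c : R} (ha : a * a = 1) (hb : b * b = 1) (hc : c * c = 1)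
  (hba : b * a = -(a * b)) (hca : c * a = -(a * c)) (hcb : c * b = -(b * c))

include ha hba hca in
theorem trivector_mul_first : a * b * c * a = b * c := by
  rw [mul_assoc, hca, mul_neg, mul_assoc, ← mul_assoc b, hba, neg_mul, mul_neg, neg_neg, mul_assoc,
    ← mul_assoc a a, ha, one_mul]

include hb hcb in
theorem trivector_mul_second : a * b * c * b = -(a * c) := by
  rw [mul_assoc, hcb, mul_neg, mul_assoc, ← mul_assoc b, hb, one_mul]

include hc in
theorem trivector_mul_third : a * b * c * c = a * b := by
  rw [mul_assoc, hc, mul_one]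

end Words

theorem pseudoscalar_mul_zero :
    pseudoscalar * vec (basisVec 0) = vec (basisVec 1) * vec (basisVec 2) :=
  trivector_mul_first (basisVec_mul_self 0) (basisVec_mul_swap (by decide))
    (basisVec_mul_swap (by decide))

theorem pseudoscalar_mul_one :
    pseudoscalar * vec (basisVec 1) = -(vec (basisVec 0) * vec (basisVec 2)) :=
  trivector_mul_second (basisVec_mul_self 1) (basisVec_mul_swap (by decide))

theorem pseudoscalar_mul_two :
    pseudoscalar * vec (basisVec 2) = vec (basisVec 0) * vec (basisVec 1) :=
  trivector_mul_third (basisVec_mul_self 2)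

theorem pseudoscalar_mul_self : pseudoscalar * pseudoscalar = -1 := by
  conv_lhs => enter [2]; rw [pseudoscalar]
  rw [← mul_assoc, ← mul_assoc, pseudoscalar_mul_zero, mul_assoc _ (vec (basisVec 2)),
    basisVec_mul_swap (i := 2) (j := 1) (by decide), mul_neg, ← mul_assoc, basisVec_mul_self,
    one_mul, neg_mul, basisVec_mul_self]

theorem basisVec_mul_pseudoscalar (i : Fin 3) :
    vec (basisVec i) * pseudoscalar = pseudoscalar * vec (basisVec i) := by
  fin_cases i
  · change vec (basisVec 0) * pseudoscalar = pseudoscalar * vec (basisVec 0)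
    rw [pseudoscalar_mul_zero, pseudoscalar, ← mul_assoc, ← mul_assoc, basisVec_mul_self, one_mul]
  · change vec (basisVec 1) * pseudoscalar = pseudoscalar * vec (basisVec 1)
    rw [pseudoscalar_mul_one, pseudoscalar, ← mul_assoc, ← mul_assoc,
      basisVec_mul_swap (i := 1) (j := 0) (by decide), neg_mul, mul_assoc (vec (basisVec 0)),
      basisVec_mul_self, mul_one, neg_mul]
  · change vec (basisVec 2) * pseudoscalar = pseudoscalar * vec (basisVec 2)
    rw [pseudoscalar_mul_two, pseudoscalar, ← mul_assoc, ← mul_assoc,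
      basisVec_mul_swap (i := 2) (j := 0) (by decide), neg_mul, mul_assoc (vec (basisVec 0)),
      basisVec_mul_swap (i := 2) (j := 1) (by decide), mul_neg, neg_neg, mul_assoc, mul_assoc,
      basisVec_mul_self, mul_one]

/-- Each `eᵢ` commutes with itself and anticommutes with the two other factors of `I`, so the signs
cancel. -/
theorem vec_mul_pseudoscalar (u : R3) : vec u * pseudoscalar = pseudoscalar * vec u := by
  rw [eq_sum_basisVec u, map_sum, Finset.sum_mul, Finset.mul_sum]
  exact Finset.sum_congr rfl fun i _ => by
    rw [map_smul, smul_mul_assoc, mul_smul_comm, basisVec_mul_pseudoscalar]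

theorem toExterior_vec (u : R3) : toExterior (vec u) = ExteriorAlgebra.ι ℝ u :=
  CliffordAlgebra.changeForm_ι
    CliffordAlgebra.changeForm.associated_neg_proof u

theorem associated_neg_Q3_apply (u v : R3) :
    QuadraticMap.associated (R := ℝ) (-Q3) u v = -inner ℝ u v := by
  rw [QuadraticMap.associated_apply]
  change ⅟(2 : ℝ) • (-inner ℝ (u + v) (u + v) - -inner ℝ u u - -inner ℝ v v) = _
  rw [inner_add_left, inner_add_right, inner_add_right, real_inner_comm u v, invOf_eq_inv,
    smul_eq_mul]
  ring

theorem toExterior_vec_mul_vec (u v : R3) : toExterior (vec u * vec v) =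
    ExteriorAlgebra.ι ℝ u * ExteriorAlgebra.ι ℝ v + algebraMap ℝ _ (inner ℝ u v) := by
  refine (CliffordAlgebra.changeForm_ι_mul_ι
    CliffordAlgebra.changeForm.associated_neg_proof u v).trans ?_
  rw [associated_neg_Q3_apply, map_neg, sub_neg_eq_add]

theorem toExterior_algebraMap (r : ℝ) : toExterior (algebraMap ℝ G3 r) = algebraMap ℝ _ r :=
  CliffordAlgebra.changeForm_algebraMap
    CliffordAlgebra.changeForm.associated_neg_proof r

/-- The identification with the exterior algebra differs from a product only by contraction terms,
which vanish for orthogonal vectors. -/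
theorem toExterior_pseudoscalar : toExterior pseudoscalar =
    ExteriorAlgebra.ι ℝ (basisVec 0) *
      (ExteriorAlgebra.ι ℝ (basisVec 1) * ExteriorAlgebra.ι ℝ (basisVec 2)) := by
  rw [pseudoscalar, mul_assoc]
  refine (CliffordAlgebra.changeForm_ι_mul
    CliffordAlgebra.changeForm.associated_neg_proof _ _).trans ?_
  have h : CliffordAlgebra.changeForm CliffordAlgebra.changeForm.associated_neg_proof
      (vec (basisVec 1) * vec (basisVec 2)) = ExteriorAlgebra.ι ℝ (basisVec 1) *
        ExteriorAlgebra.ι ℝ (basisVec 2) := by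
    have := toExterior_vec_mul_vec (basisVec 1) (basisVec 2)
    rw [inner_basisVec, if_neg (by decide), map_zero, add_zero] at this
    exact this
  rw [h, sub_eq_self]
  refine (CliffordAlgebra.contractLeft_ι_mul _ _ _).trans ?_
  erw [CliffordAlgebra.contractLeft_ι]
  rw [associated_neg_Q3_apply, associated_neg_Q3_apply, inner_basisVec, inner_basisVec,
    if_neg (by decide), if_neg (by decide)]
  simp

theorem mem_kVectors {k : ℕ} {A : G3} : A ∈ kVectors k ↔ toExterior A ∈ ⋀[ℝ]^k R3 := Iff.rfl

theorem algebraMap_mem_kVectors (r : ℝ) : algebraMap ℝ G3 r ∈ kVectors 0 := by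
  rw [mem_kVectors, toExterior_algebraMap]
  exact SetLike.algebraMap_mem_graded (fun n : ℕ => ⋀[ℝ]^n R3) r

theorem ι_mem_exteriorPower_one (u : R3) : ExteriorAlgebra.ι ℝ u ∈ ⋀[ℝ]^1 R3 := by
  rw [ExteriorAlgebra.exteriorPower, pow_one]; exact ⟨u, rfl⟩

theorem vec_mem_kVectors (u : R3) : vec u ∈ kVectors 1 := by
  rw [mem_kVectors, toExterior_vec]; exact ι_mem_exteriorPower_one u

theorem vec_mul_vec_sub_mem_kVectors (u v : R3) :
    vec u * vec v - algebraMap ℝ G3 (inner ℝ u v) ∈ kVectors 2 := by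
  rw [mem_kVectors, map_sub, toExterior_vec_mul_vec, toExterior_algebraMap, add_sub_cancel_right]
  exact SetLike.mul_mem_graded (A := fun n : ℕ => ⋀[ℝ]^n R3) (ι_mem_exteriorPower_one u)
    (ι_mem_exteriorPower_one v)

theorem pseudoscalar_mem_kVectors : pseudoscalar ∈ kVectors 3 := by
  rw [mem_kVectors, toExterior_pseudoscalar]
  exact SetLike.mul_mem_graded (A := fun n : ℕ => ⋀[ℝ]^n R3) (ι_mem_exteriorPower_one _)
    (SetLike.mul_mem_graded (A := fun n : ℕ => ⋀[ℝ]^n R3) (ι_mem_exteriorPower_one _)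
      (ι_mem_exteriorPower_one _))

theorem gradeProj_of_mem {k : ℕ} {A : G3} (hA : A ∈ kVectors k) (j : ℕ) :
    gradeProj j A = if j = k then A else 0 := by
  have h : gradeProj j A = toExterior.symm
      (GradedAlgebra.proj (fun n : ℕ => ⋀[ℝ]^n R3) j (toExterior A)) := rfl
  rw [h, GradedAlgebra.proj_apply]
  split_ifs with hjk
  · subst hjk
    rw [DirectSum.decompose_of_mem_same (fun n : ℕ => ⋀[ℝ]^n R3) (mem_kVectors.1 hA), LinearEquiv.symm_apply_apply]
  · rw [DirectSum.decompose_of_mem_ne (fun n : ℕ => ⋀[ℝ]^n R3) (mem_kVectors.1 hA) (Ne.symm hjk), map_zero]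

theorem wedge_of_mem {r s : ℕ} (hr : r < 4) (hs : s < 4) {A B : G3} (hA : A ∈ kVectors r)
    (hB : B ∈ kVectors s) : wedge A B = gradeProj (r + s) (A * B) := by
  unfold wedge
  rw [Finset.sum_eq_single_of_mem r (Finset.mem_range.2 hr), Finset.sum_eq_single_of_mem s
    (Finset.mem_range.2 hs)]
  · rw [gradeProj_of_mem hA, gradeProj_of_mem hB, if_pos rfl, if_pos rfl]
  · intro j _ hj
    rw [gradeProj_of_mem hB, if_neg hj, mul_zero, map_zero]
  · intro j _ hj
    refine Finset.sum_eq_zero fun i _ => ?_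
    rw [gradeProj_of_mem hA, if_neg hj, zero_mul, map_zero]

theorem dot_of_mem {r s : ℕ} (hr : r < 4) (hs : s < 4) {A B : G3} (hA : A ∈ kVectors r)
    (hB : B ∈ kVectors s) : dot A B = gradeProj ((r : ℤ) - (s : ℤ)).natAbs (A * B) := by
  unfold dot
  rw [Finset.sum_eq_single_of_mem r (Finset.mem_range.2 hr), Finset.sum_eq_single_of_mem s
    (Finset.mem_range.2 hs)]
  · rw [gradeProj_of_mem hA, gradeProj_of_mem hB, if_pos rfl, if_pos rfl]
  · intro j _ hj
    rw [gradeProj_of_mem hB, if_neg hj, mul_zero, map_zero]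
  · intro j _ hj
    refine Finset.sum_eq_zero fun i _ => ?_
    rw [gradeProj_of_mem hA, if_neg hj, zero_mul, map_zero]

/-- The duality map `v ↦ I v`. -/
noncomputable def dualMap : R3 →ₗ[ℝ] G3 := LinearMap.mulLeft ℝ pseudoscalar ∘ₗ vec

theorem dualMap_apply (u : R3) : dualMap u = pseudoscalar * vec u := rfl

theorem basisVec_mul_basisVec_mem_range_dualMap {i j : Fin 3} (h : i ≠ j) :
    vec (basisVec i) * vec (basisVec j) ∈ LinearMap.range dualMap := by
  have h01 : vec (basisVec 0) * vec (basisVec 1) ∈ LinearMap.range dualMap :=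
    ⟨basisVec 2, pseudoscalar_mul_two⟩
  have h12 : vec (basisVec 1) * vec (basisVec 2) ∈ LinearMap.range dualMap :=
    ⟨basisVec 0, pseudoscalar_mul_zero⟩
  have h02 : vec (basisVec 0) * vec (basisVec 2) ∈ LinearMap.range dualMap :=
    ⟨-basisVec 1, by rw [map_neg, dualMap_apply, pseudoscalar_mul_one, neg_neg]⟩
  have hswap : ∀ {i j : Fin 3}, i ≠ j → vec (basisVec i) * vec (basisVec j) ∈
      LinearMap.range dualMap → vec (basisVec j) * vec (basisVec i) ∈ LinearMap.range dualMap :=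
    fun h hm => by rw [basisVec_mul_swap h.symm]; exact neg_mem hm
  fin_cases i <;> fin_cases j
  · exact absurd rfl h
  · exact h01
  · exact h02
  · exact hswap (by decide) h01
  · exact absurd rfl h
  · exact h12
  · exact hswap (by decide) h02
  · exact hswap (by decide) h12
  · exact absurd rfl h

/-- Bilinear expansion reduces to basis vectors: equal ones contribute `1 - 1 = 0`, distinct ones a
product `eᵢeⱼ`, which is `±I` times the third basis vector. -/
theorem vec_mul_vec_sub_mem_range_dualMap (u v : R3) :
    vec u * vec v - algebraMap ℝ G3 (inner ℝ u v) ∈ LinearMap.range dualMap := by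
  have h : vec u * vec v - algebraMap ℝ G3 (inner ℝ u v) = ∑ i, ∑ j, (u i * v j) •
      (vec (basisVec i) * vec (basisVec j) -
        algebraMap ℝ G3 (inner ℝ (basisVec i) (basisVec j))) := by
    simp only [smul_sub, Finset.sum_sub_distrib]
    congr 1
    · conv_lhs => rw [eq_sum_basisVec u, eq_sum_basisVec v]
      simp only [map_sum, map_smul, Finset.sum_mul_sum, smul_mul_smul_comm]
    · conv_lhs => rw [eq_sum_basisVec u, eq_sum_basisVec v]
      simp only [sum_inner, inner_sum, real_inner_smul_left, real_inner_smul_right, map_sum,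
        ← mul_assoc, map_mul, Algebra.smul_def]
      rw [Finset.sum_comm]
      refine Finset.sum_congr rfl fun i _ => Finset.sum_congr rfl fun j _ => ?_
      simp only [← map_mul]
      rw [mul_comm (v j)]
  rw [h]
  refine sum_mem fun i _ => sum_mem fun j _ => Submodule.smul_mem _ _ ?_
  by_cases hij : i = j
  · subst hij
    rw [basisVec_mul_self, inner_basisVec, if_pos rfl, map_one, sub_self]
    exact zero_mem _
  · rw [inner_basisVec, if_neg hij, map_zero, sub_zero]
    exact basisVec_mul_basisVec_mem_range_dualMap hij

theorem kVectors_two_eq_range_dualMap : kVectors 2 = LinearMap.range dualMap := by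
  apply le_antisymm
  · intro A hA
    rw [mem_kVectors, ExteriorAlgebra.exteriorPower, pow_two] at hA
    rw [← toExterior.symm_apply_apply A]
    refine Submodule.mul_induction_on hA ?_ fun x y hx hy => by
      rw [map_add]; exact add_mem hx hy
    rintro _ ⟨u, rfl⟩ _ ⟨v, rfl⟩
    have h := vec_mul_vec_sub_mem_range_dualMap u v
    rwa [← toExterior.symm_apply_apply (vec u * vec v - _), map_sub, toExterior_vec_mul_vec,
      toExterior_algebraMap, add_sub_cancel_right] at h
  · rintro _ ⟨u, rfl⟩
    rw [eq_sum_basisVec u, map_sum]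
    refine sum_mem fun i _ => ?_
    rw [map_smul]
    refine Submodule.smul_mem _ _ ?_
    have h : ∀ {i j : Fin 3}, i ≠ j → vec (basisVec i) * vec (basisVec j) ∈ kVectors 2 := by
      intro i j hij
      have := vec_mul_vec_sub_mem_kVectors (basisVec i) (basisVec j)
      rwa [inner_basisVec, if_neg hij, map_zero, sub_zero] at this
    rw [dualMap_apply]
    fin_cases i
    · exact pseudoscalar_mul_zero ▸ h (by decide)
    · exact pseudoscalar_mul_one ▸ neg_mem (h (by decide))
    · exact pseudoscalar_mul_two ▸ h (by decide)

theorem pseudoscalar_mul_dualMap (u : R3) : pseudoscalar * dualMap u = -vec u := by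
  rw [dualMap_apply, ← mul_assoc, pseudoscalar_mul_self, neg_one_mul]

theorem dualMap_injective : Function.Injective dualMap := by
  intro u v h
  have h1 : vec u = vec v := by
    rw [← neg_inj, ← pseudoscalar_mul_dualMap, ← pseudoscalar_mul_dualMap, h]
  have h2 := congrArg toExterior h1
  rw [toExterior_vec, toExterior_vec] at h2
  exact ExteriorAlgebra.ι_leftInverse.injective h2

theorem dualMap_mem_kVectors (u : R3) : dualMap u ∈ kVectors 2 :=
  kVectors_two_eq_range_dualMap ▸ LinearMap.mem_range_self _ u

/-- Since `I` is central, `a (I u) = I (a u)`. With `a u = I z + ⟪a, u⟫` this equals `-z + ⟪a, u⟫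
I`, and the grade-three part is the last term. -/
theorem wedge_vec_dualMap (a u : R3) : wedge (vec a) (dualMap u) = inner ℝ a u • pseudoscalar := by
  rw [wedge_of_mem (by norm_num) (by norm_num) (vec_mem_kVectors a) (dualMap_mem_kVectors u)]
  obtain ⟨z, hz⟩ := vec_mul_vec_sub_mem_range_dualMap a u
  have h : vec a * dualMap u = -vec z + inner ℝ a u • pseudoscalar := by
    rw [← pseudoscalar_mul_dualMap, hz, dualMap_apply, ← mul_assoc, vec_mul_pseudoscalar,
      mul_sub, mul_assoc, Algebra.smul_def, Algebra.commutes, sub_add_cancel]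
  rw [h, map_add, map_neg, map_smul, gradeProj_of_mem (vec_mem_kVectors z),
    gradeProj_of_mem pseudoscalar_mem_kVectors]
  simp

theorem dot_pseudoscalar_smul (r : ℝ) :
    dot pseudoscalar (r • pseudoscalar) = algebraMap ℝ G3 (-r) := by
  rw [dot_of_mem (by norm_num) (by norm_num) pseudoscalar_mem_kVectors
    (Submodule.smul_mem _ r pseudoscalar_mem_kVectors), mul_smul_comm, pseudoscalar_mul_self]
  have h : r • (-1 : G3) = algebraMap ℝ G3 (-r) := by
    rw [Algebra.algebraMap_eq_smul_one, smul_neg, neg_smul]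
  rw [h, gradeProj_of_mem (algebraMap_mem_kVectors _)]
  simp

/-- `(I u)(I v) = u I² v = -u v`, whose scalar part is `-⟪u, v⟫`. -/
theorem dot_dualMap_dualMap (u v : R3) :
    dot (dualMap u) (dualMap v) = algebraMap ℝ G3 (-inner ℝ v u) := by
  rw [dot_of_mem (by norm_num) (by norm_num) (dualMap_mem_kVectors u) (dualMap_mem_kVectors v)]
  have h : dualMap u * dualMap v = -(vec u * vec v - algebraMap ℝ G3 (inner ℝ u v)) +
      algebraMap ℝ G3 (-inner ℝ v u) := by
    rw [real_inner_comm u v, map_neg, neg_sub, sub_add_eq_add_sub, add_neg_cancel, zero_sub,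
      dualMap_apply u, ← vec_mul_pseudoscalar, mul_assoc, pseudoscalar_mul_dualMap, mul_neg]
  rw [h, map_add, map_neg, gradeProj_of_mem (vec_mul_vec_sub_mem_kVectors u v),
    gradeProj_of_mem (algebraMap_mem_kVectors _)]
  simp

end GeometricAlgebra

/-! ### Translation between the curl theorem and the divergence theorem. -/

section CurlTheorem

variable {M : Set R3} {F : R3 → G3} {v : R3 → R3}

/-- The vector field dual to a bivector field of class `C¹`. -/
theorem exists_dual_vectorField (hF : ContDiffOn ℝ 1 F M) (hF2 : ∀ x ∈ M, F x ∈ kVectors 2) :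
    ∃ v : R3 → R3, ContDiffOn ℝ 1 v M ∧ ∀ x ∈ M, F x = dualMap (v x) := by
  -- A linear left inverse of duality on all of `𝔾₃`, automatically continuous, carries the `C¹`
  -- regularity of `F` over to `v`.
  obtain ⟨T, hT⟩ :=
    dualMap.exists_leftInverse_of_injective (LinearMap.ker_eq_bot.2 dualMap_injective)
  refine ⟨fun x => T (F x), T.toContinuousLinearMap.contDiff.comp_contDiffOn hF, fun x hx => ?_⟩
  obtain ⟨u, hu⟩ := kVectors_two_eq_range_dualMap.le (hF2 x hx)
  beta_reduce
  rw [← hu, show T (dualMap u) = u from LinearMap.congr_fun hT u]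

/-- Duality is a constant linear map, so `∂ᵢF = I ∂ᵢv`, and `eᵢ ∧ (I ∂ᵢv)` is the `i`-th component
of `∂ᵢv` times `I`. -/
theorem curl_eq_divergence_smul (hv : ContDiffOn ℝ 1 v M) (hFv : ∀ x ∈ M, F x = dualMap (v x))
    {x : R3} (hx : x ∈ interior M) : curl M F x = divergence M v x • pseudoscalar := by
  have hxM : M ∈ nhds x := mem_interior_iff_mem_nhds.1 hx
  have hd : DifferentiableAt ℝ v x := (hv.differentiableOn (by norm_num)).differentiableAt hxM
  have hF : HasFDerivAt F (dualMap.toContinuousLinearMap.comp (fderiv ℝ v x)) x := by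
    refine (dualMap.toContinuousLinearMap.hasFDerivAt.comp x hd.hasFDerivAt).congr_of_eventuallyEq ?_
    filter_upwards [hxM] with y hy
    exact hFv y hy
  unfold curl divergence
  rw [fderivWithin_of_mem_nhds hxM, fderivWithin_of_mem_nhds hxM, hF.fderiv, Finset.sum_smul]
  refine Finset.sum_congr rfl fun i _ => ?_
  refine (wedge_vec_dualMap _ _).trans ?_
  congr 1
  simp [basisVec, EuclideanSpace.inner_single_left]

theorem integrable_algebraMap_neg {α : Type*} [MeasurableSpace α] {μ : Measure α} {f : α → ℝ}
    (hf : Integrable f μ) : Integrable (fun x => algebraMap ℝ G3 (-f x)) μ := by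
  simp only [Algebra.algebraMap_eq_smul_one]
  exact hf.neg.smul_const 1

theorem integral_algebraMap_neg {α : Type*} [MeasurableSpace α] {μ : Measure α} (f : α → ℝ) :
    ∫ x, algebraMap ℝ G3 (-f x) ∂μ = algebraMap ℝ G3 (-∫ x, f x ∂μ) := by
  simp only [Algebra.algebraMap_eq_smul_one]
  rw [integral_smul_const, integral_neg]

end CurlTheorem

theorem mainTheorem1 (M : Set R3) (hM : IsPiecewiseSmoothRegion M) (F : R3 → G3)
    (hF : ContDiffOn ℝ 1 F M) (hF2 : ∀ x ∈ M, F x ∈ kVectors 2) :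
    (IntegrableOn (fun x => dot pseudoscalar (curl M F x)) M volume ∧
      IntegrableOn (fun x => dot (surfaceElement M x) (F x)) (frontier M) μHE[2] ∧
      ∫ x in M, dot pseudoscalar (curl M F x) =
        ∫ x in frontier M, dot (surfaceElement M x) (F x) ∂μHE[2]) ∧
    ∃ v : R3 → R3, (∀ x ∈ M, F x = pseudoscalar * vec (v x)) ∧
      (∀ x ∈ interior M, curl M F x = divergence M v x • pseudoscalar) ∧
      (∀ x ∈ frontier M, dot (surfaceElement M x) (F x) =
        algebraMap ℝ G3 (-inner ℝ (v x) (outwardNormal M x))) ∧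
      IntegrableOn (divergence M v) M volume ∧
      IntegrableOn (fun x => inner ℝ (v x) (outwardNormal M x)) (frontier M) μHE[2] ∧
      ∫ x in M, divergence M v x =
        ∫ x in frontier M, inner ℝ (v x) (outwardNormal M x) ∂μHE[2] := by

  obtain ⟨v, hv, hFv⟩ := exists_dual_vectorField hF hF2
  have hcurl : ∀ x ∈ interior M, curl M F x = divergence M v x • pseudoscalar := fun x hx =>
    curl_eq_divergence_smul hv hFv hx
  have hsurf : ∀ x ∈ frontier M, dot (surfaceElement M x) (F x) =
      algebraMap ℝ G3 (-inner ℝ (v x) (outwardNormal M x)) := fun x hx => by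
    rw [hFv x (hM.isCompact.isClosed.frontier_subset hx)]
    exact dot_dualMap_dualMap _ _
  have hdiv := integrableOn_divergence hM hv
  have hnor := integrableOn_inner_outwardNormal hM hv
  have hmain := integral_divergence_eq hM hv
  -- The curl formula is available only in the interior, which suffices because the frontier has
  -- zero volume.
  have hvol : (fun x => algebraMap ℝ G3 (-divergence M v x)) =ᵐ[volume.restrict M]
      fun x => dot pseudoscalar (curl M F x) := by
    rw [← Measure.restrict_congr_set (interior_ae_eq hM)]
    filter_upwards [ae_restrict_mem isOpen_interior.measurableSet] with x hx
    rw [hcurl x hx, dot_pseudoscalar_smul]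
  have harea : (fun x => algebraMap ℝ G3 (-inner ℝ (v x) (outwardNormal M x)))
      =ᵐ[μHE[2].restrict (frontier M)] fun x => dot (surfaceElement M x) (F x) := by
    filter_upwards [ae_restrict_mem isClosed_frontier.measurableSet] with x hx
    exact (hsurf x hx).symm
  refine ⟨⟨(integrable_algebraMap_neg hdiv).congr hvol, (integrable_algebraMap_neg hnor).congr harea,
    ?_⟩, v, hFv, hcurl, hsurf, hdiv, hnor, hmain⟩
  rw [← integral_congr_ae hvol, ← integral_congr_ae harea, integral_algebraMap_neg,
    integral_algebraMap_neg, hmain]
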